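/- **Setting.** Let $n\in\{2,3\}$. A fractured medium in $\mathbb R^n$ consists of finitely many flat, connected polyhedral subdomains $\Omega_i$ of dimensions $d_i\in\{0,\dots,n\}$ (rock, fractures, intersections), and of interfaces $\Gamma_j$; each $\Gamma_j$ is one side of (a part of) a subdomain $\Omega_{l(j)}$ and belongs to the boundary of a subdomain $\Omega_{u(j)}$ with $d_{u(j)}=d_{l(j)}+1$. The medium is connected. Its boundary is split into a Neumann part and a Dirichlet part, the latter containing a face of an $n$-dimensional subdomain. Each $\Omega_i$ has a simplicial mesh (elements $T$, faces $f$), conforming except possibly across fractures and resolving the interfaces and the boundary parts; each $\Gamma_j$ has a simplicial mortar mesh, which need not match the others. The meshes of the subdomains have shape-regularity constant $\sigma$: every element $T$ contains a ball of some radius $\rho_T>0$ with $\operatorname{diam}T\le\sigma\rho_T$. The permeability $K$ is a symmetric positive definite tensor, constant on each subdomain; the normal permeability $K_\nu>0$ and the aperture $\gamma>0$ are constant on each interface. Say that $K$ has anisotropy at most $\kappa$ if on each subdomain $\lambda_{\max}(K)\le\kappa\,\lambda_{\min}(K)$ ($\kappa=1$: isotropic $K$). Let $V_{h}$ be the lowest-order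 Raviart–Thomas space on all subdomains of dimension $\ge1$, with zero normal component on the Neumann boundary, $V_{0h}\subset V_h$ the fluxes with zero normal component on the interfaces, $\Lambda_h$ the piecewise constants on the mortar meshes, $Q_h$ the piecewise constants on the meshes of the subdomains, and $W_h=V_{0h}\times\Lambda_h$. Let $R_h:\Lambda_h\to V_h$ be the extension whose normal component on each face lying on an interface is the mean value of $\lambda$ over that face (the $L^2$ projection to face-wise constants), and is zero on all other faces. Let $[\![\mu]\!]|_{\Omega_i}=-\sum_{l(j)=i}\mu|_{\Gamma_j}$. For $w=(u_0,\lambda)$, $r=(v_0,\mu)\in W_h$, $p\in Q_h$ and $u=u_0+R_h\lambda$, $v=v_0+R_h\mu$ put $$a(w,r)=(K^{-1}u,v)_\Omega+(\gamma K_\nu^{-1}\lambda,\mu)_\Gamma,\qquad b(r,p)=-(p,\nabla\cdot v+[\![\mu]\!])_\Omega,$$ $$a^D(w,r)=\sum_{T}\sum_{f\subset\partial T}(u\cdot\nu_f)(v\cdot\nu_f)(K^{-1}\phi_f,\phi_f)_T+(\gamma K_\nu^{-1}\lambda,\mu)_\Gamma ,$$ where $\phi_f$ is the Raviart–Thomas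 basis function on $T$ with outward normal component $1$ on $f$ and $0$ on the other faces of $T$. Let $A,D_A:W_h\to W_h'$ and $B:W_h\to Q_h'$ be the operators of $a$, $a^D$, $b$, let $S=BD_A^{-1}B^T$, and $$\mathcal A=\begin{pmatrix}A&B^T\\-B&0\end{pmatrix},\qquad \mathcal B_D=\begin{pmatrix}A&0\\0&S\end{pmatrix}^{-1},\qquad \mathcal B_U=\begin{pmatrix}A&B^T\\0&S\end{pmatrix}^{-1},$$ $(x',y')_{\mathcal B_D}=\langle x',\mathcal B_Dy'\rangle$ and $\|x'\|_{\mathcal B_D}^2=(x',x')_{\mathcal B_D}$ on $W_h'\times Q_h'$. **Theorem.** The inverses above exist and $(\cdot,\cdot)_{\mathcal B_D}$ is an inner product. There are a constant $\xi_1>0$, depending only on $n$ and $\sigma$, and for each $\kappa$ a constant $\xi_2>0$, depending only on $n$, $\sigma$ and $\kappa$, such that for all media and meshes with shape-regularity constant $\sigma$, all $K$ of anisotropy at most $\kappa$, all $K_\nu,\gamma$, and all $x'=\mathcal B_U^{-1}x$ with $x=(w_h,p_h)\in W_h\times Q_h$, $x\ne0$, $$\xi_1\le\frac{(\mathcal A\mathcal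 B_Ux',x')_{\mathcal B_D}}{(x',x')_{\mathcal B_D}}\qquad\text{and}\qquad\frac{\|\mathcal A\mathcal B_Ux'\|_{\mathcal B_D}}{\|x'\|_{\mathcal B_D}}\le\xi_2 .$$ In particular, for isotropic $K$ the constants depend neither on the mesh sizes nor on $K$, $K_\nu$, $\gamma$, but only on $n$ and $\sigma$. -/

import Mathlib

open scoped Matrix
open MeasureTheory

noncomputable section

namespace MixedDim

/-- `d`-dimensional Euclidean space. -/
abbrev Eu (d : ℕ) : Type := EuclideanSpace ℝ (Fin d)

/-- The convex hull (closed simplex) of a simplex. -/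
def hull {d : ℕ} (s : Affine.Simplex ℝ (Eu d) d) : Set (Eu d) :=
  convexHull ℝ (Set.range s.points)

/-- Height of the simplex over the face opposite to the vertex `k`. -/
def height {d : ℕ} (s : Affine.Simplex ℝ (Eu d) d) (k : Fin (d + 1)) : ℝ :=
  Metric.infDist (s.points k) (affineSpan ℝ (s.points '' {k}ᶜ) : Set (Eu d))

/-- Lowest-order Raviart-Thomas basis function of the face opposite to the vertex `k`:
its outward normal component is `1` on that face and `0` on all other faces.  The functions
`x ↦ a + b • x` on the simplex are exactly the linear combinations of these `d + 1` functions,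
the coefficients being the (constant) outward normal components on the faces. -/
def rtBasis {d : ℕ} (s : Affine.Simplex ℝ (Eu d) d) (k : Fin (d + 1)) (x : Eu d) : Eu d :=
  (height s k)⁻¹ • (x - s.points k)

/-- The divergence of a vector field. -/
def divergence {d : ℕ} (v : Eu d → Eu d) (x : Eu d) : ℝ :=
  LinearMap.trace ℝ (Eu d) (fderiv ℝ v x).toLinearMap

/-- The data of a mixed-dimensional fractured medium in `ℝⁿ` with simplicial meshes and mortar
meshes.  A subdomain `i` of dimension `d = dim i` is flat, and `chart i` are Cartesian coordinates
on the `d`-dimensional affine subspace containing it.  -/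
structure Grid (n : ℕ) where
  /-- the subdomains of all dimensions (rock, fractures, intersections of fractures, ...) -/
  Sub : Type
  dim : Sub → ℕ
  chart : ∀ i, Eu (dim i) →ᵃⁱ[ℝ] Eu n
  /-- the interfaces: each one is one side of a (part of a) subdomain `lower j`, and belongs to the
  boundary of the subdomain `upper j`, whose dimension is one higher -/
  Ifc : Type
  lower : Ifc → Sub
  upper : Ifc → Sub
  /-- the elements of the subdomain meshes, in the coordinates of their subdomain -/
  Cell : Type
  [fintypeCell : Fintype Cell]
  sub : Cell → Sub
  simplex : ∀ T : Cell, Affine.Simplex ℝ (Eu (dim (sub T))) (dim (sub T))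
  /-- the elements of the mortar meshes, in the coordinates of the lower subdomain -/
  Mortar : Type
  [fintypeMortar : Fintype Mortar]
  ifc : Mortar → Ifc
  mortarSimplex : ∀ m : Mortar,
    Affine.Simplex ℝ (Eu (dim (lower (ifc m)))) (dim (lower (ifc m)))
  /-- the interface which the face opposite to the vertex `k` of the element `T` lies on, if any -/
  faceIfc : (Σ T : Cell, Fin (dim (sub T) + 1)) → Option Ifc
  /-- the element faces on the Neumann (no flow) part of the boundary -/
  neumann : Set (Σ T : Cell, Fin (dim (sub T) + 1))

namespace Grid

variable {n : ℕ} (M : Grid n)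

instance : Fintype M.Cell := M.fintypeCell
instance : Fintype M.Mortar := M.fintypeMortar

/-- The faces of the elements; `⟨T, k⟩` is the face of `T` opposite to the vertex `k`. A face shared
by two elements appears twice, once from either side. -/
abbrev Face : Type := Σ T : M.Cell, Fin (M.dim (M.sub T) + 1)

/-- Dimension of an element. -/
def cdim (T : M.Cell) : ℕ := M.dim (M.sub T)

/-- Closed element, as a subset of `ℝⁿ`. -/
def closedCell (T : M.Cell) : Set (Eu n) := M.chart (M.sub T) '' hull (M.simplex T)

/-- Relatively open element, as a subset of `ℝⁿ`. -/
def openCell (T : M.Cell) : Set (Eu n) := M.chart (M.sub T) '' interior (hull (M.simplex T))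

/-- The vertices of an element, as points of `ℝⁿ`. -/
def verts (T : M.Cell) : Set (Eu n) := M.chart (M.sub T) '' Set.range (M.simplex T).points

/-- The vertices of a face, as points of `ℝⁿ`. -/
def faceVerts (f : M.Face) : Set (Eu n) :=
  M.chart (M.sub f.1) '' ((M.simplex f.1).points '' {f.2}ᶜ)

/-- Closed face, as a subset of `ℝⁿ`. -/
def faceSet (f : M.Face) : Set (Eu n) := convexHull ℝ (M.faceVerts f)

/-- The union of all (closed) subdomains whose dimension is one less than `d`. -/
def below (d : ℕ) : Set (Eu n) := ⋃ (C : M.Cell) (_ : M.cdim C + 1 = d), M.closedCell C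

/-- The set `Γⱼ`, in the coordinates of the lower subdomain. -/
def ifcSet (j : M.Ifc) : Set (Eu n) :=
  ⋃ (m : M.Mortar) (_ : M.ifc m = j), M.chart (M.lower (M.ifc m)) '' hull (M.mortarSimplex m)

/-- Two faces are glued if they are the same face of two different elements of the same subdomain
and this face does not lie on an interface. -/
def Glued (f g : M.Face) : Prop :=
  f.1 ≠ g.1 ∧ M.sub f.1 = M.sub g.1 ∧ M.faceVerts f = M.faceVerts g ∧
    M.faceIfc f = none ∧ M.faceIfc g = none

/-- A boundary face: neither interior to its subdomain nor on an interface. -/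
def IsBoundary (f : M.Face) : Prop :=
  0 < M.cdim f.1 ∧ M.faceIfc f = none ∧ ∀ g, ¬ M.Glued f g

/-- The conditions which make the data a triangulated mixed-dimensional domain. -/
structure IsAdmissible : Prop where
  dim_upper : ∀ j, M.dim (M.upper j) = M.dim (M.lower j) + 1
  /-- elements (of any dimension) do not overlap; in particular the elements of a mesh do not cross
  the subdomains of lower dimension -/
  disjoint_cells : ∀ S T : M.Cell, S ≠ T → Disjoint (M.openCell S) (M.openCell T)
  /-- the mesh of a subdomain is conforming, except possibly across a fracture -/
  conforming : ∀ S T : M.Cell, S ≠ T → M.sub S = M.sub T →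
    M.closedCell S ∩ M.closedCell T = convexHull ℝ (M.verts S ∩ M.verts T) ∨
      M.closedCell S ∩ M.closedCell T ⊆ M.below (M.cdim S)
  /-- each subdomain is connected -/
  connected_sub : ∀ S T : M.Cell, M.sub S = M.sub T →
    Relation.ReflTransGen (fun S' T' => ∃ f g : M.Face, f.1 = S' ∧ g.1 = T' ∧ M.Glued f g) S T
  /-- the whole medium is connected -/
  connected : ∀ i i' : M.Sub,
    Relation.EqvGen (fun a c => ∃ j, M.lower j = a ∧ M.upper j = c) i i'
  /-- the faces on an interface are faces of elements of the upper subdomain -/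
  faceIfc_upper : ∀ f j, M.faceIfc f = some j → M.sub f.1 = M.upper j
  /-- the faces on interfaces are those contained in subdomains of the next lower dimension -/
  faceIfc_isSome : ∀ f, 0 < M.cdim f.1 → M.faceSet f ⊆ M.below (M.cdim f.1) →
    M.faceIfc f ≠ none
  /-- the interface is a part of the lower subdomain ... -/
  ifcSet_lower : ∀ j, M.ifcSet j ⊆ ⋃ (C : M.Cell) (_ : M.sub C = M.lower j), M.closedCell C
  /-- ... triangulated by the faces of the elements of the upper subdomain ... -/
  ifcSet_faces : ∀ j, M.ifcSet j = ⋃ (f : M.Face) (_ : M.faceIfc f = some j), M.faceSet f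
  faces_overlap : ∀ j (f g : M.Face), M.faceIfc f = some j → M.faceIfc g = some j → f ≠ g →
    volume (M.chart (M.lower j) ⁻¹' (M.faceSet f ∩ M.faceSet g)) = 0
  /-- ... and also by the elements of the mortar mesh -/
  mortar_nonempty : ∀ j, ∃ m, M.ifc m = j
  disjoint_mortar : ∀ m m' : M.Mortar, m ≠ m' → M.ifc m = M.ifc m' →
    Disjoint (M.chart (M.lower (M.ifc m)) '' interior (hull (M.mortarSimplex m)))
      (M.chart (M.lower (M.ifc m')) '' interior (hull (M.mortarSimplex m')))
  neumann_boundary : ∀ f ∈ M.neumann, M.IsBoundary f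
  /-- the Dirichlet part of the boundary has positive measure -/
  dirichlet : ∃ f : M.Face, M.cdim f.1 = n ∧ M.IsBoundary f ∧ f ∉ M.neumann

/-- Shape regularity of the subdomain meshes: the ratio of the diameter of an element to the radius
of an inscribed ball is at most `σ`. -/
def ShapeRegular (σ : ℝ) : Prop :=
  ∀ T : M.Cell, ∃ c : Eu (M.dim (M.sub T)), ∃ ρ : ℝ, 0 < ρ ∧
    Metric.closedBall c ρ ⊆ hull (M.simplex T) ∧ Metric.diam (hull (M.simplex T)) ≤ σ * ρ

/-- The physical parameters: the permeability tensor, constant on each subdomain, and the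
normal permeability and the aperture, constant on each interface. -/
structure Params where
  K : ∀ i : M.Sub, Matrix (Fin (M.dim i)) (Fin (M.dim i)) ℝ
  K_posDef : ∀ i, (K i).PosDef
  Kν : M.Ifc → ℝ
  Kν_pos : ∀ j, 0 < Kν j
  γ : M.Ifc → ℝ
  γ_pos : ∀ j, 0 < γ j

/-- On each subdomain the largest eigenvalue of the permeability tensor is at most `κ` times the
smallest one (`κ = 1`: isotropic permeability). -/
def Params.AnisotropyLE {M : Grid n} (P : M.Params) (κ : ℝ) : Prop :=
  ∀ (i : M.Sub) (u v : Eu (M.dim i)),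
    inner ℝ (Matrix.toEuclideanLin (P.K i) u) u * ‖v‖ ^ 2 ≤
      κ * inner ℝ (Matrix.toEuclideanLin (P.K i) v) v * ‖u‖ ^ 2

/-! The discrete spaces -/

/-- The Raviart-Thomas space on all subdomains (zero in dimension `0`).  An element is given by its
outward normal components on the faces of all elements; these are opposite on glued faces, and zero
on the Neumann boundary. -/
def fluxSpace : Submodule ℝ (M.Face → ℝ) where
  carrier := {c | (∀ f g, M.Glued f g → c f + c g = 0) ∧ (∀ f ∈ M.neumann, c f = 0) ∧
    ∀ f, M.cdim f.1 = 0 → c f = 0}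
  add_mem' := by
    rintro a c ⟨h1, h2, h3⟩ ⟨k1, k2, k3⟩
    refine ⟨fun f g h => ?_, fun f h => ?_, fun f h => ?_⟩
    · have := h1 f g h
      have := k1 f g h
      simp only [Pi.add_apply]
      linarith
    · simp [h2 f h, k2 f h]
    · simp [h3 f h, k3 f h]
  zero_mem' := by simp
  smul_mem' := by
    rintro r c ⟨h1, h2, h3⟩
    refine ⟨fun f g h => ?_, fun f h => ?_, fun f h => ?_⟩
    · simp only [Pi.smul_apply, smul_eq_mul, ← mul_add, h1 f g h, mul_zero]
    · simp [h2 f h]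
    · simp [h3 f h]

/-- The fluxes with zero normal component on the interfaces. -/
def fluxSpace₀ : Submodule ℝ (M.Face → ℝ) :=
  M.fluxSpace ⊓
    { carrier := {c | ∀ f, M.faceIfc f ≠ none → c f = 0}
      add_mem' := fun h k f hf => by simp [h f hf, k f hf]
      zero_mem' := by simp
      smul_mem' := fun r c h f hf => by simp [h f hf] }

/-- Piecewise constant mortar functions. -/
abbrev MortarSpace : Type := M.Mortar → ℝ

/-- The space of all flux variables. -/
abbrev W : Type := M.fluxSpace₀ × M.MortarSpace

/-- Piecewise constant pressures. -/
abbrev Q : Type := M.Cell → ℝ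

/-- The vector field on the element `T` with the given outward normal components. -/
def field (T : M.Cell) (c : M.Face → ℝ) (x : Eu (M.dim (M.sub T))) : Eu (M.dim (M.sub T)) :=
  ∑ k, c ⟨T, k⟩ • rtBasis (M.simplex T) k x

open Classical in
/-- The `L²` projection of a mortar function on the interface `j` to the normal traces of the upper
fluxes, which are the functions that are constant on each face: its value on the face `f` is
the mean value over `f`. -/
def proj (j : M.Ifc) (f : M.Face) (μ : M.MortarSpace) : ℝ :=
  (∑ m : M.Mortar with M.ifc m = j,
    μ m * volume.real (hull (M.mortarSimplex m) ∩ M.chart (M.lower (M.ifc m)) ⁻¹' M.faceSet f)) /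
    volume.real (M.chart (M.lower j) ⁻¹' M.faceSet f)

/-- The discrete extension operator: the flux with the projected normal component on the
interfaces, and with zero normal component on all other faces. -/
def ext : M.MortarSpace →ₗ[ℝ] (M.Face → ℝ) where
  toFun μ f := (M.faceIfc f).elim 0 fun j => M.proj j f μ
  map_add' μ μ' := by
    funext f
    rcases h : M.faceIfc f with _ | j
    · simp [h]
    · simp [h, proj, add_mul, Finset.sum_add_distrib, add_div]
  map_smul' r μ := by
    funext f
    rcases h : M.faceIfc f with _ | j
    · simp [h]
    · simp [h, proj, mul_assoc, ← Finset.mul_sum, mul_div_assoc]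

/-- The total flux `u₀ + R λ`. -/
def totalFlux : M.W →ₗ[ℝ] (M.Face → ℝ) :=
  M.fluxSpace₀.subtype ∘ₗ LinearMap.fst ℝ _ _ + M.ext ∘ₗ LinearMap.snd ℝ _ _

variable {M}

theorem field_add (T : M.Cell) (c c' : M.Face → ℝ) (x : Eu (M.dim (M.sub T))) :
    M.field T (c + c') x = M.field T c x + M.field T c' x := by
  simp [field, add_smul, Finset.sum_add_distrib]

theorem field_smul (T : M.Cell) (r : ℝ) (c : M.Face → ℝ) (x : Eu (M.dim (M.sub T))) :
    M.field T (r • c) x = r • M.field T c x := by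
  simp [field, mul_smul, Finset.smul_sum]

theorem field_contDiff (T : M.Cell) (c : M.Face → ℝ) : ContDiff ℝ 1 (M.field T c) := by
  unfold field rtBasis
  fun_prop

theorem isCompact_hull {d : ℕ} (s : Affine.Simplex ℝ (Eu d) d) : IsCompact (hull s) :=
  (Set.finite_range s.points).isCompact_convexHull ℝ

namespace Params

/-- The inverse of the permeability tensor. -/
def invK (P : M.Params) (i : M.Sub) : Eu (M.dim i) →ₗ[ℝ] Eu (M.dim i) :=
  Matrix.toEuclideanLin (P.K i)⁻¹

theorem integrableOn_inner (P : M.Params) (T : M.Cell) (c c' : M.Face → ℝ) :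
    IntegrableOn (fun x => inner ℝ (P.invK (M.sub T) (M.field T c x)) (M.field T c' x))
      (hull (M.simplex T)) volume := by
  apply ContinuousOn.integrableOn_compact (isCompact_hull _)
  apply Continuous.continuousOn
  exact Continuous.inner (𝕜 := ℝ)
    ((LinearMap.continuous_of_finiteDimensional (P.invK (M.sub T))).comp
      (field_contDiff T c).continuous)
    (field_contDiff T c').continuous

/-- `(K⁻¹ u, v)_Ω`. -/
def mass (P : M.Params) : (M.Face → ℝ) →ₗ[ℝ] (M.Face → ℝ) →ₗ[ℝ] ℝ :=
  LinearMap.mk₂ ℝ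
    (fun c c' => ∑ T, ∫ x in hull (M.simplex T),
      inner ℝ (P.invK (M.sub T) (M.field T c x)) (M.field T c' x))
    (fun c₁ c₂ c' => by
      simp only [field_add, map_add, inner_add_left, ← Finset.sum_add_distrib]
      refine Finset.sum_congr rfl fun T _ => ?_
      exact integral_add (P.integrableOn_inner T c₁ c') (P.integrableOn_inner T c₂ c'))
    (fun r c c' => by
      simp only [field_smul, map_smul, real_inner_smul_left, Finset.mul_sum, smul_eq_mul]
      exact Finset.sum_congr rfl fun _ _ => integral_const_mul (L := ℝ) _ _)
    (fun c c₁ c₂ => by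
      simp only [field_add, inner_add_right, ← Finset.sum_add_distrib]
      refine Finset.sum_congr rfl fun T _ => ?_
      exact integral_add (P.integrableOn_inner T c c₁) (P.integrableOn_inner T c c₂))
    (fun r c c' => by
      simp only [field_smul, real_inner_smul_right, Finset.mul_sum, smul_eq_mul]
      exact Finset.sum_congr rfl fun _ _ => integral_const_mul (L := ℝ) _ _)

/-- `(K⁻¹ u, v)_{D,Ω}`: the element matrices of `(K⁻¹ u, v)_Ω` are replaced by their diagonals. -/
def massD (P : M.Params) : (M.Face → ℝ) →ₗ[ℝ] (M.Face → ℝ) →ₗ[ℝ] ℝ :=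
  LinearMap.mk₂ ℝ
    (fun c c' => ∑ T, ∑ k, c ⟨T, k⟩ * c' ⟨T, k⟩ * ∫ x in hull (M.simplex T),
      inner ℝ (P.invK (M.sub T) (rtBasis (M.simplex T) k x)) (rtBasis (M.simplex T) k x))
    (fun c₁ c₂ c' => by simp [add_mul, Finset.sum_add_distrib])
    (fun r c c' => by simp [Finset.mul_sum, mul_assoc])
    (fun c c₁ c₂ => by simp [mul_add, add_mul, Finset.sum_add_distrib])
    (fun r c c' => by simp [Finset.mul_sum, mul_assoc, mul_left_comm])

/-- `(γ Kν⁻¹ λ, μ)_Γ`. -/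
def mortarMass (P : M.Params) : M.MortarSpace →ₗ[ℝ] M.MortarSpace →ₗ[ℝ] ℝ :=
  LinearMap.mk₂ ℝ
    (fun l μ => ∑ m, P.γ (M.ifc m) * (P.Kν (M.ifc m))⁻¹ * (l m * μ m) *
      volume.real (hull (M.mortarSimplex m)))
    (fun l l' μ => by simp [mul_add, add_mul, Finset.sum_add_distrib])
    (fun r l μ => by
      simp only [Pi.smul_apply, smul_eq_mul, Finset.mul_sum]
      exact Finset.sum_congr rfl fun _ _ => by ring)
    (fun l μ μ' => by simp [mul_add, add_mul, Finset.sum_add_distrib])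
    (fun r l μ => by
      simp only [Pi.smul_apply, smul_eq_mul, Finset.mul_sum]
      exact Finset.sum_congr rfl fun _ _ => by ring)

/-- The operator `A`, `⟨A w, r⟩ = a(w, r) = (K⁻¹(u₀ + Rλ), v₀ + Rμ)_Ω + (γ Kν⁻¹ λ, μ)_Γ`. -/
def opA (P : M.Params) : M.W →ₗ[ℝ] Module.Dual ℝ M.W :=
  P.mass.compl₁₂ M.totalFlux M.totalFlux +
    P.mortarMass.compl₁₂ (LinearMap.snd ℝ _ _) (LinearMap.snd ℝ _ _)

/-- The operator `D_A`, `⟨D_A w, r⟩ = (K⁻¹(u₀ + Rλ), v₀ + Rμ)_{D,Ω} + (γ Kν⁻¹ λ, μ)_Γ`. -/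
def opDA (P : M.Params) : M.W →ₗ[ℝ] Module.Dual ℝ M.W :=
  P.massD.compl₁₂ M.totalFlux M.totalFlux +
    P.mortarMass.compl₁₂ (LinearMap.snd ℝ _ _) (LinearMap.snd ℝ _ _)

end Params

theorem divergence_field_add (T : M.Cell) (c c' : M.Face → ℝ) (x : Eu (M.dim (M.sub T))) :
    divergence (M.field T (c + c')) x =
      divergence (M.field T c) x + divergence (M.field T c') x := by
  have h : M.field T (c + c') = M.field T c + M.field T c' := funext (field_add T c c')
  have hc := (field_contDiff T c).differentiable one_ne_zero x
  have hc' := (field_contDiff T c').differentiable one_ne_zero x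
  simp [divergence, h, fderiv_add hc hc']

theorem divergence_field_smul (T : M.Cell) (r : ℝ) (c : M.Face → ℝ)
    (x : Eu (M.dim (M.sub T))) :
    divergence (M.field T (r • c)) x = r * divergence (M.field T c) x := by
  have h : M.field T (r • c) = r • M.field T c := funext (field_smul T r c)
  have hc := (field_contDiff T c).differentiable one_ne_zero x
  simp [divergence, h, fderiv_const_smul hc]

theorem integrableOn_divergence (T : M.Cell) (c : M.Face → ℝ) :
    IntegrableOn (fun x => divergence (M.field T c) x) (hull (M.simplex T)) volume := by
  apply ContinuousOn.integrableOn_compact (isCompact_hull _)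
  apply Continuous.continuousOn
  have h : Continuous (fun x => fderiv ℝ (M.field T c) x) :=
    (field_contDiff T c).continuous_fderiv one_ne_zero
  let L : (Eu (M.dim (M.sub T)) →L[ℝ] Eu (M.dim (M.sub T))) →ₗ[ℝ] ℝ :=
    LinearMap.trace ℝ _ ∘ₗ ContinuousLinearMap.coeLM ℝ
  exact (LinearMap.continuous_of_finiteDimensional L).comp h

variable (M)

/-- `(∇ · v, p)_Ω`. -/
def divForm : (M.Face → ℝ) →ₗ[ℝ] M.Q →ₗ[ℝ] ℝ :=
  LinearMap.mk₂ ℝ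
    (fun c p => ∑ T, ∫ x in hull (M.simplex T), p T * divergence (M.field T c) x)
    (fun c c' p => by
      simp only [integral_const_mul, divergence_field_add, ← Finset.sum_add_distrib, ← mul_add]
      refine Finset.sum_congr rfl fun T _ => ?_
      rw [integral_add (integrableOn_divergence T c) (integrableOn_divergence T c')])
    (fun r c p => by
      simp only [divergence_field_smul, integral_const_mul, Finset.mul_sum, smul_eq_mul]
      exact Finset.sum_congr rfl fun _ _ => by ring)
    (fun c p p' => by
      simp only [integral_const_mul, Pi.add_apply]
      simp only [add_mul, Finset.sum_add_distrib])
    (fun r c p => by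
      simp only [integral_const_mul, Pi.smul_apply, smul_eq_mul, Finset.mul_sum, mul_assoc])

open Classical in
/-- `(⟦μ⟧, p)_Ω`, where the jump `⟦μ⟧` on a subdomain is minus the sum of the mortar functions
on the interfaces of this subdomain. -/
def jumpForm : M.MortarSpace →ₗ[ℝ] M.Q →ₗ[ℝ] ℝ :=
  LinearMap.mk₂ ℝ
    (fun μ p => -∑ m, ∑ C : M.Cell with M.sub C = M.lower (M.ifc m), μ m * p C *
      volume.real (hull (M.mortarSimplex m) ∩
        M.chart (M.lower (M.ifc m)) ⁻¹' M.closedCell C))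
    (fun μ μ' p => by
      simp only [Pi.add_apply, add_mul, Finset.sum_add_distrib, neg_add])
    (fun r μ p => by
      simp only [Pi.smul_apply, smul_eq_mul, mul_neg, Finset.mul_sum, mul_assoc])
    (fun μ p p' => by
      simp only [Pi.add_apply, mul_add, add_mul, Finset.sum_add_distrib, neg_add])
    (fun r μ p => by
      simp only [Pi.smul_apply, smul_eq_mul, mul_neg, Finset.mul_sum, mul_assoc,
        mul_left_comm _ r])

/-- The operator `B`, `⟨B r, p⟩ = b(r, p) = -(p, ∇ · (v₀ + Rμ) + ⟦μ⟧)_Ω`. -/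
def opB : M.W →ₗ[ℝ] Module.Dual ℝ M.Q :=
  -(M.divForm.compl₁₂ M.totalFlux LinearMap.id +
    M.jumpForm.compl₁₂ (LinearMap.snd ℝ _ _) LinearMap.id)

end Grid

/-! Block operators -/

open Classical in
/-- The inverse of a bijective linear map. -/
def linInv {X Y : Type*} [AddCommGroup X] [Module ℝ X] [AddCommGroup Y] [Module ℝ Y]
    (T : X →ₗ[ℝ] Y) : Y →ₗ[ℝ] X :=
  if h : Function.Bijective T then (LinearEquiv.ofBijective T h).symm.toLinearMap else 0

section Block

variable {W Q : Type*} [AddCommGroup W] [Module ℝ W] [AddCommGroup Q] [Module ℝ Q]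

/-- The operator with the block matrix `(E F; G H)`. -/
def block (E : W →ₗ[ℝ] Module.Dual ℝ W) (F : Q →ₗ[ℝ] Module.Dual ℝ W)
    (G : W →ₗ[ℝ] Module.Dual ℝ Q) (H : Q →ₗ[ℝ] Module.Dual ℝ Q) :
    W × Q →ₗ[ℝ] Module.Dual ℝ W × Module.Dual ℝ Q :=
  (E.coprod F).prod (G.coprod H)

/-- The duality pairing. -/
def pairing (x' : Module.Dual ℝ W × Module.Dual ℝ Q) (x : W × Q) : ℝ := x'.1 x.1 + x'.2 x.2

/-- `(x', y')_𝓜 = ⟨x', 𝓜 y'⟩`. -/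
def dualInner (M : Module.Dual ℝ W × Module.Dual ℝ Q →ₗ[ℝ] W × Q)
    (x' y' : Module.Dual ℝ W × Module.Dual ℝ Q) : ℝ := pairing x' (M y')

/-- `‖x'‖_𝓜`. -/
def dualNorm (M : Module.Dual ℝ W × Module.Dual ℝ Q →ₗ[ℝ] W × Q)
    (x' : Module.Dual ℝ W × Module.Dual ℝ Q) : ℝ := √(dualInner M x' x')

end Block

namespace Grid.Params

variable {n : ℕ} {M : Grid n} (P : M.Params)

/-- `B D_A⁻¹ Bᵀ`. -/
def schur : M.Q →ₗ[ℝ] Module.Dual ℝ M.Q := M.opB ∘ₗ linInv P.opDA ∘ₗ M.opB.flip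

/-- The operator `𝓐 = (A Bᵀ; -B 0)` of the discrete problem. -/
def calA : M.W × M.Q →ₗ[ℝ] Module.Dual ℝ M.W × Module.Dual ℝ M.Q :=
  block P.opA M.opB.flip (-M.opB) 0

/-- The block diagonal operator `(A 0; 0 B D_A⁻¹ Bᵀ)`. -/
def blockD : M.W × M.Q →ₗ[ℝ] Module.Dual ℝ M.W × Module.Dual ℝ M.Q :=
  block P.opA 0 0 P.schur

/-- The block upper triangular operator `(A Bᵀ; 0 B D_A⁻¹ Bᵀ)`. -/
def blockU : M.W × M.Q →ₗ[ℝ] Module.Dual ℝ M.W × Module.Dual ℝ M.Q :=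
  block P.opA M.opB.flip 0 P.schur

/-- The block diagonal preconditioner. -/
def calBD : Module.Dual ℝ M.W × Module.Dual ℝ M.Q →ₗ[ℝ] M.W × M.Q := linInv P.blockD

/-- The block upper triangular preconditioner. -/
def calBU : Module.Dual ℝ M.W × Module.Dual ℝ M.Q →ₗ[ℝ] M.W × M.Q := linInv P.blockU

end Grid.Params

end MixedDim

end

/-! Write `D` for `D_A` and measure everything in the energy norms of `A` and `D`. For `x = (w, p)`
put `z = A⁻¹Bᵀp` and `q = -S⁻¹Bw`. Then `x' = 𝓑_U⁻¹x` and `𝓐x` are the images of `(w + z, p)` and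
`(w + z, q)` under the block diagonal operator, so the `𝓑_D`-products are sums of an `A`-product and
an `S`-product. The field-of-values numerator becomes `|w|² + (z, w) + |z|² = (|w|² + |z|² + |w +
z|²)/2` in the `A`-norm, while the denominator is `|w + z|² + S(p, p)`. Here `S(p, p)` is the dual
`D`-norm of `Bᵀp`, and `|z|²` is its dual `A`-norm. Thus `A ≤ c₁D` gives the lower bound and `D ≤
c₂A` the upper one (`block_preconditioner`).

Three facts about the medium feed this argument. First, `Bᵀ` is injective, which makes `S` definite
(`opB_flip_injective`): a pressure annihilated by all test fluxes agrees across inner faces, hence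
is constant on subdomains; mortar functions equate the constants across interfaces, and a Dirichlet
face makes them zero. Second, `c₁ = n + 1` holds for every element by Cauchy-Schwarz, since an
element has at most `n + 1` faces (`mass_le_massD`). No mesh quality or anisotropy enters, so `ξ₁`
is free of `κ`. Third, `c₂` comes from bounding each degree of freedom of a Raviart-Thomas function
by its size on a ball inside the element (`exists_ball_abs_le_norm`, `massD_le_mass`). Only this
last estimate uses `σ` and `κ` in its constant. The mortar term is common to `A` and `D`, so `K_ν`
and `γ` drop out. -/

noncomputable section

namespace MixedDim

/-! ### Field-of-values bounds for abstract block preconditioners -/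

section AbstractPreconditioner

variable {W Q : Type*} [AddCommGroup W] [Module ℝ W] [AddCommGroup Q] [Module ℝ Q]

theorem linInv_apply {X Y : Type*} [AddCommGroup X] [Module ℝ X] [AddCommGroup Y] [Module ℝ Y]
    {T : X →ₗ[ℝ] Y} (h : Function.Bijective T) (x : X) : linInv T (T x) = x := by
  rw [linInv, dif_pos h]
  exact LinearEquiv.ofBijective_symm_apply_apply T x

theorem apply_linInv {X Y : Type*} [AddCommGroup X] [Module ℝ X] [AddCommGroup Y] [Module ℝ Y]
    {T : X →ₗ[ℝ] Y} (h : Function.Bijective T) (y : Y) : T (linInv T y) = y := by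
  obtain ⟨x, rfl⟩ := h.2 y
  rw [linInv_apply h]

/-- A symmetric positive definite operator to the dual space. -/
structure IsSPD (A : W →ₗ[ℝ] Module.Dual ℝ W) : Prop where
  symm : ∀ x y, A x y = A y x
  pos : ∀ x, x ≠ 0 → 0 < A x x

namespace IsSPD

variable {A D : W →ₗ[ℝ] Module.Dual ℝ W}

theorem nonneg (hA : IsSPD A) (x : W) : 0 ≤ A x x := by
  rcases eq_or_ne x 0 with rfl | h
  · simp
  · exact (hA.pos x h).le

theorem sq_le (hA : IsSPD A) (x y : W) : A x y ^ 2 ≤ A x x * A y y := by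
  have h := LinearMap.BilinForm.apply_mul_apply_le_of_forall_zero_le A hA.nonneg x y
  rw [hA.symm y x] at h
  nlinarith

theorem bijective [FiniteDimensional ℝ W] (hA : IsSPD A) : Function.Bijective A := by
  have hinj : Function.Injective A := by
    rw [injective_iff_map_eq_zero]
    intro x hx
    by_contra h
    have := hA.pos x h
    simp [hx] at this
  exact ⟨hinj, (LinearMap.injective_iff_surjective_of_finrank_eq_finrank
    Subspace.dual_finrank_eq.symm).1 hinj⟩

/-- The inequality of the quadratic forms is reversed for the dual quadratic forms. -/
theorem dual_le (hA : IsSPD A) (hD : IsSPD D) {c : ℝ} (h : ∀ w, A w w ≤ c * D w w) {y z : W}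
    (hyz : D y = A z) : D y y ≤ c * A z z := by
  -- Since `D y y = A z y`, this is Cauchy-Schwarz for `A`; combined with `A y y ≤ c * D y y`, one
  -- factor `D y y` cancels.
  have h1 : D y y ^ 2 ≤ A z z * A y y := by
    conv_lhs => rw [hyz]
    exact hA.sq_le z y
  have h2 := h y
  rcases (hD.nonneg y).eq_or_lt with h0 | h0
  · have hy : y = 0 := by
      by_contra hne
      exact (hD.pos y hne).ne h0
    have hz : z = 0 := by
      by_contra hne
      have := hA.pos z hne
      rw [← hyz, hy] at this
      simp at this
    simp [hy, hz]
  · have h3 : D y y * D y y ≤ (c * A z z) * D y y := by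
      nlinarith [mul_le_mul_of_nonneg_left h2 (hA.nonneg z)]
    exact le_of_mul_le_mul_right h3 h0

end IsSPD

variable [FiniteDimensional ℝ W] {A D : W →ₗ[ℝ] Module.Dual ℝ W} {B : W →ₗ[ℝ] Module.Dual ℝ Q}

/-- The form is the `D`-product of the vectors `D⁻¹Bᵀq` and `D⁻¹Bᵀp`, so definiteness is exactly the
injectivity of `Bᵀ`. -/
theorem IsSPD.schur (hD : IsSPD D) (hB : Function.Injective B.flip) :
    IsSPD (B ∘ₗ linInv D ∘ₗ B.flip) := by
  have key : ∀ p q, (B ∘ₗ linInv D ∘ₗ B.flip) p q =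
      D (linInv D (B.flip q)) (linInv D (B.flip p)) := by
    intro p q
    rw [apply_linInv hD.bijective]
    rfl
  refine ⟨fun p q => by rw [key, key, hD.symm], fun p hp => ?_⟩
  rw [key]
  refine hD.pos _ fun h => hp ?_
  apply hB
  rw [map_zero, ← apply_linInv hD.bijective (B.flip p), h, map_zero]

theorem IsSPD.block_bijective [FiniteDimensional ℝ Q] {S : Q →ₗ[ℝ] Module.Dual ℝ Q} (hA : IsSPD A) (hS : IsSPD S)
    (F : Q →ₗ[ℝ] Module.Dual ℝ W) : Function.Bijective (block A F 0 S) := by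
  constructor
  · rw [injective_iff_map_eq_zero]
    rintro ⟨w, p⟩ h
    simp only [block, LinearMap.prod_apply, Function.prod, LinearMap.coprod_apply,
      LinearMap.zero_apply, zero_add, Prod.mk_eq_zero] at h
    have hp : p = 0 := hS.bijective.1 (by rw [h.2, map_zero])
    subst hp
    have hw : w = 0 := hA.bijective.1 (by simpa using h.1)
    rw [hw]; rfl
  · rintro ⟨f, g⟩
    obtain ⟨p, rfl⟩ := hS.bijective.2 g
    obtain ⟨w, hw⟩ := hA.bijective.2 (f - F p)
    exact ⟨(w, p), by simp [block, hw]⟩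

/-- The field-of-values bounds for the block triangular preconditioner, in an abstract setting. -/
theorem block_preconditioner [FiniteDimensional ℝ Q] {c₁ c₂ : ℝ} (hc₁ : 0 ≤ c₁) (hc₂ : 0 ≤ c₂) (hA : IsSPD A)
    (hD : IsSPD D) (hB : Function.Injective B.flip)
    (hAD : ∀ w, A w w ≤ c₁ * D w w) (hDA : ∀ w, D w w ≤ c₂ * A w w) :
    let S := B ∘ₗ linInv D ∘ₗ B.flip
    let BD := linInv (block A 0 0 S)
    let BU := linInv (block A B.flip 0 S)
    let 𝓐 := block A B.flip (-B) 0
    Function.Bijective D ∧ Function.Bijective (block A 0 0 S) ∧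
    Function.Bijective (block A B.flip 0 S) ∧
    (∀ x' y', dualInner BD x' y' = dualInner BD y' x') ∧
    (∀ x', x' ≠ 0 → 0 < dualInner BD x' x') ∧
    ∀ x : W × Q, x ≠ 0 → ∀ x', x' = block A B.flip 0 S x →
      (2 * (2 + c₁))⁻¹ ≤ dualInner BD (𝓐 (BU x')) x' / dualInner BD x' x' ∧
      dualNorm BD (𝓐 (BU x')) / dualNorm BD x' ≤ √(1 + 2 * c₂ + 2 * c₂ ^ 2) := by
  intro S BD BU 𝓐
  have hS : IsSPD S := hD.schur hB
  have hbD := hA.block_bijective hS 0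
  have hbU := hA.block_bijective hS B.flip
  have hin : ∀ u v : W × Q, dualInner BD (block A 0 0 S u) (block A 0 0 S v) =
      A u.1 v.1 + S u.2 v.2 := by
    intro u v
    simp only [dualInner, BD, linInv_apply hbD]
    simp [pairing, block]
  have hpos : ∀ x', x' ≠ 0 → 0 < dualInner BD x' x' := by
    intro x' hx'
    obtain ⟨u, rfl⟩ := hbD.2 x'
    rw [hin]
    by_cases h1 : u.1 = 0
    · have h2 : u.2 ≠ 0 := fun h2 => hx' (by rw [show u = 0 from Prod.ext h1 h2, map_zero])
      linarith [hA.nonneg u.1, hS.pos u.2 h2]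
    · linarith [hS.nonneg u.2, hA.pos u.1 h1]
  refine ⟨hD.bijective, hbD, hbU, fun x' y' => ?_, hpos, ?_⟩
  · obtain ⟨u, rfl⟩ := hbD.2 x'
    obtain ⟨v, rfl⟩ := hbD.2 y'
    rw [hin, hin, hA.symm, hS.symm]
  rintro ⟨w, p⟩ hx x' rfl
  have hBU : BU (block A B.flip 0 S (w, p)) = (w, p) := linInv_apply hbU _
  rw [hBU]
  have hx0 : block A B.flip 0 S (w, p) ≠ 0 := fun h => hx (hbU.1 (by rw [h, map_zero]))
  have hpos' := hpos _ hx0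
  -- With `z = A⁻¹Bᵀp` and `q = -S⁻¹Bw`, both vectors to be compared are images under the block
  -- diagonal operator (`e1`, `e2`), where `hin` evaluates the inner product.
  obtain ⟨z, hz⟩ := hA.bijective.2 (B.flip p)
  obtain ⟨q, hq⟩ := hS.bijective.2 (-B w)
  have e1 : block A B.flip 0 S (w, p) = block A 0 0 S (w + z, p) := by
    simp [block, hz]
  have e2 : 𝓐 (w, p) = block A 0 0 S (w + z, q) := by
    simp [𝓐, block, hz, hq]
  rw [e1] at hpos' ⊢
  rw [e2]
  simp only [dualNorm]
  rw [hin] at hpos' ⊢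
  rw [hin, hin]
  simp only at hpos' ⊢
  have hSS : ∀ r s, S r s = D (linInv D (B.flip s)) (linInv D (B.flip r)) := by
    intro r s
    rw [apply_linInv hD.bijective]
    rfl
  have hSqp : S q p = -A z w := by
    rw [hq, hz]; rfl
  have hAadd : A (w + z) (w + z) = A w w + 2 * A z w + A z z := by
    simp only [map_add, LinearMap.add_apply, hA.symm w z]; ring
  set y := linInv D (B.flip p) with hy
  have hDy : D y = A z := by rw [hy, apply_linInv hD.bijective, hz]
  have hSpp : S p p = D y y := hSS p p
  have hw0 := hA.nonneg w
  have hz0 := hA.nonneg z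
  have hwz0 := hA.nonneg (w + z)
  have hwz1 := hA.nonneg (w - z)
  have hAsub : A (w - z) (w - z) = A w w - 2 * A z w + A z z := by
    simp only [map_sub, LinearMap.sub_apply, hA.symm w z]; ring
  constructor
  -- As `S q p = -A z w`, the numerator is half of `|w|² + |z|² + |w + z|²`, and the denominator is
  -- at most `|w + z|² + c₁|z|²` by `dual_le`.
  · rw [inv_eq_one_div, div_le_div_iff₀ (by positivity) hpos', hSqp, hSpp]
    have h1 := hA.dual_le hD hAD hDy
    rw [hAadd] at hwz0 ⊢
    rw [hAsub] at hwz1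
    nlinarith [mul_nonneg hc₁ hw0, mul_nonneg hc₁ hwz0]
  · rw [← Real.sqrt_div' _ hpos'.le]
    apply Real.sqrt_le_sqrt
    rw [div_le_iff₀ hpos', hSpp]
    have h1 : A z z ≤ c₂ * D y y := hD.dual_le hA hDA hDy.symm
    -- The vector `-t = -D⁻¹Bᵀq` is the `D`-orthogonal projection of `w` onto the range of `D⁻¹Bᵀ`,
    -- so `S q q = D t t ≤ D w w`.
    have h2 : S q q ≤ c₂ * A w w := by
      set t := linInv D (B.flip q) with ht
      have hDt : D t = B.flip q := apply_linInv hD.bijective _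
      have e3 : S q q = D t t := hSS q q
      have e4 : S q q = -D t w := by
        rw [hDt, hq]; rfl
      have h3 := hD.sq_le t w
      have h4 := hD.nonneg t
      have h5 : D t t ≤ D w w := by
        rcases h4.eq_or_lt with h0 | h0
        · rw [← h0]; exact hD.nonneg w
        · refine le_of_mul_le_mul_left ?_ h0
          have : D t t = -D t w := by rw [← e3, e4]
          calc D t t * D t t = D t w ^ 2 := by rw [this]; ring
            _ ≤ _ := h3
      rw [e3]
      exact h5.trans (hDA w)
    -- The difference of the two sides is `A (w + 2z) (w + 2z)`.
    have h3 : A w w ≤ 2 * A (w + z) (w + z) + 2 * A z z := by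
      have := hA.nonneg (w + z + z)
      have e : A (w + z + z) (w + z + z) = A w w + 4 * A z w + 4 * A z z := by
        simp only [map_add, LinearMap.add_apply, hA.symm w z]; ring
      rw [e] at this
      rw [hAadd]
      linarith
    have hy0 := hD.nonneg y
    nlinarith [mul_le_mul_of_nonneg_left h3 hc₂, mul_le_mul_of_nonneg_left h1 hc₂,
      mul_nonneg hc₂ hwz0, mul_nonneg (sq_nonneg c₂) hwz0, mul_nonneg hc₂ hy0]

end AbstractPreconditioner

/-! ### Heights, normals and volumes of simplices -/

section SimplexGeometry

variable {d : ℕ} (s : Affine.Simplex ℝ (Eu d) d)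

/-- The vertices of a simplex of full dimension, as an affine basis. -/
def vertexBasis : AffineBasis (Fin (d + 1)) ℝ (Eu d) :=
  ⟨s.points, s.independent, s.span_eq_top finrank_euclideanSpace_fin⟩

@[simp]
theorem vertexBasis_apply (j : Fin (d + 1)) : vertexBasis s j = s.points j := rfl

theorem interior_hull : interior (hull s) = {x | ∀ i, 0 < (vertexBasis s).coord i x} :=
  (vertexBasis s).interior_convexHull

theorem interior_hull_nonempty : (interior (hull s)).Nonempty := by
  rw [hull, interior_convexHull_nonempty_iff_affineSpan_eq_top]
  exact s.span_eq_top finrank_euclideanSpace_fin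

theorem measurableSet_hull : MeasurableSet (hull s) := (Grid.isCompact_hull s).measurableSet

theorem volume_hull_pos : 0 < volume (hull s) :=
  ((isOpen_interior.measure_pos volume (interior_hull_nonempty s))).trans_le
    (measure_mono interior_subset)

theorem volume_hull_ne_top : volume (hull s) ≠ ⊤ := (Grid.isCompact_hull s).measure_lt_top.ne

theorem volume_real_hull_pos : 0 < volume.real (hull s) :=
  ENNReal.toReal_pos (volume_hull_pos s).ne' (volume_hull_ne_top s)

theorem height_eq [NeZero d] (k : Fin (d + 1)) : height s k = s.height k := by
  rw [height, Affine.Simplex.height, Affine.Simplex.altitudeFoot,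
    Affine.Simplex.orthogonalProjectionSpan, ← Affine.Simplex.range_faceOpposite_points]
  exact (EuclideanGeometry.dist_orthogonalProjection_eq_infDist _ _).symm

theorem height_pos [NeZero d] (k : Fin (d + 1)) : 0 < height s k := by
  rw [height_eq]
  exact s.height_pos k

/-- The outward unit normal of a face. -/
theorem exists_unit_normal [NeZero d] (k : Fin (d + 1)) :
    ∃ ν : Eu d, ‖ν‖ = 1 ∧ ∀ j, j ≠ k → inner ℝ (s.points j - s.points k) ν = height s k := by
  have hpos := s.height_pos k
  -- The normal points from the vertex `k` to the foot of its altitude.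
  refine ⟨(s.height k)⁻¹ • (s.altitudeFoot k - s.points k), ?_, fun j hj => ?_⟩
  · rw [norm_smul, ← dist_eq_norm, dist_comm, ← Affine.Simplex.height, Real.norm_eq_abs,
      abs_inv, abs_of_pos hpos, inv_mul_cancel₀ hpos.ne']
  · have h := s.inner_vsub_vsub_altitudeFoot_eq_height_sq hj.symm
    rw [vsub_eq_sub, vsub_eq_sub] at h
    rw [inner_smul_right, ← neg_sub (s.points k), ← neg_sub (s.points k), inner_neg_neg, h,
      height_eq]
    field_simp

/-- The closed face opposite to the vertex `k`. -/
def faceHull (k : Fin (d + 1)) : Set (Eu d) := convexHull ℝ (s.points '' {k}ᶜ)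

variable {s}

theorem inner_normal_of_mem_faceHull {k : Fin (d + 1)} {ν : Eu d}
    (hν : ∀ j, j ≠ k → inner ℝ (s.points j - s.points k) ν = height s k) {x : Eu d}
    (hx : x ∈ faceHull s k) : inner ℝ (x - s.points k) ν = height s k := by
  have hc : Convex ℝ {x : Eu d | inner ℝ (x - s.points k) ν = height s k} := by
    intro x hx y hy a b _ _ hab
    simp only [Set.mem_ofPred_eq] at hx hy ⊢
    have : a • x + b • y - s.points k = a • (x - s.points k) + b • (y - s.points k) := by
      rw [smul_sub, smul_sub, ← sub_eq_zero]
      have : s.points k = a • s.points k + b • s.points k := by rw [← add_smul, hab, one_smul]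
      nth_rw 1 [this]
      abel
    rw [this, inner_add_left, real_inner_smul_left, real_inner_smul_left, hx, hy, ← add_mul, hab,
      one_mul]
  refine convexHull_min ?_ hc hx
  rintro _ ⟨j, hj, rfl⟩
  exact hν j hj

variable (s)

theorem range_points_eq_insert (k : Fin (d + 1)) :
    Set.range s.points = insert (s.points k) (s.points '' {k}ᶜ) := by
  rw [← Set.image_insert_eq, Set.insert_eq, Set.union_compl_self, Set.image_univ]

theorem faceHull_nonempty [NeZero d] (k : Fin (d + 1)) : (faceHull s k).Nonempty := by
  rw [faceHull, convexHull_nonempty_iff, Set.image_nonempty]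
  obtain ⟨j, hj⟩ := exists_ne k
  exact ⟨j, hj⟩

theorem mem_hull_iff [NeZero d] (k : Fin (d + 1)) {x : Eu d} :
    x ∈ hull s ↔ ∃ z ∈ faceHull s k, ∃ t ∈ Set.Icc (0 : ℝ) 1,
      x = s.points k + t • (z - s.points k) := by
  have hne := (convexHull_nonempty_iff (𝕜 := ℝ)).1 (faceHull_nonempty s k)
  rw [hull, range_points_eq_insert s k, convexHull_insert hne, convexJoin_singleton_left]
  simp only [Set.mem_iUnion, exists_prop, segment_eq_image', Set.mem_image, faceHull]
  constructor
  · rintro ⟨z, hz, t, ht, rfl⟩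
    exact ⟨z, hz, t, ht, rfl⟩
  · rintro ⟨z, hz, t, ht, rfl⟩
    exact ⟨z, hz, t, ht, rfl⟩

variable {s}

theorem inner_normal_mem_Icc [NeZero d] {k : Fin (d + 1)} {ν : Eu d}
    (hν : ∀ j, j ≠ k → inner ℝ (s.points j - s.points k) ν = height s k) {x : Eu d}
    (hx : x ∈ hull s) : inner ℝ (x - s.points k) ν ∈ Set.Icc 0 (height s k) := by
  obtain ⟨z, hz, t, ht, rfl⟩ := (mem_hull_iff s k).1 hx
  rw [add_sub_cancel_left, real_inner_smul_left, inner_normal_of_mem_faceHull hν hz]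
  have := height_pos s k
  exact ⟨mul_nonneg ht.1 this.le, mul_le_of_le_one_left this.le ht.2⟩

/-- The height of a simplex is at least the diameter of an inscribed ball. -/
theorem two_mul_le_height [NeZero d] {c : Eu d} {ρ : ℝ} (hρ : 0 ≤ ρ)
    (hb : Metric.closedBall c ρ ⊆ hull s) (k : Fin (d + 1)) : 2 * ρ ≤ height s k := by
  obtain ⟨ν, hν1, hν⟩ := exists_unit_normal s k
  -- The simplex lies in a slab of width `height s k`; the two poles `c ± ρν` of the ball are `2ρ`
  -- apart across it.
  have h1 := (inner_normal_mem_Icc hν (hb (show c + ρ • ν ∈ _ by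
    simp [norm_smul, hν1, abs_of_nonneg hρ]))).2
  have h2 := (inner_normal_mem_Icc hν (hb (show c - ρ • ν ∈ _ by
    simp [norm_smul, hν1, abs_of_nonneg hρ]))).1
  rw [show c + ρ • ν - s.points k = (c - s.points k) + ρ • ν by abel, inner_add_left,
    real_inner_smul_left, real_inner_self_eq_norm_sq, hν1] at h1
  rw [show c - ρ • ν - s.points k = (c - s.points k) - ρ • ν by abel, inner_sub_left,
    real_inner_smul_left, real_inner_self_eq_norm_sq, hν1] at h2
  linarith

variable (s)

/-- The section of a simplex by a hyperplane parallel to a face. -/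
theorem hull_inter_hyperplane [NeZero d] {k : Fin (d + 1)} {ν : Eu d} (hν1 : ‖ν‖ = 1)
    (hν : ∀ j, j ≠ k → inner ℝ (s.points j - s.points k) ν = height s k) (t : ℝ) :
    hull s ∩ AffineSubspace.mk' (t • (height s k • ν) +ᵥ s.points k) (ℝ ∙ (height s k • ν))ᗮ =
      if t ∈ Set.Icc (0 : ℝ) 1 then AffineMap.homothety (s.points k) t '' faceHull s k else ∅ := by
  have hpos := height_pos s k
  have hmem : ∀ x : Eu d,
      x ∈ AffineSubspace.mk' (t • (height s k • ν) +ᵥ s.points k) (ℝ ∙ (height s k • ν))ᗮ ↔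
        inner ℝ (x - s.points k) ν = t * height s k := by
    intro x
    rw [AffineSubspace.mem_mk', Submodule.mem_orthogonal_singleton_iff_inner_left, vsub_eq_sub,
      vadd_eq_add, ← sub_sub, sub_right_comm, inner_sub_left, inner_smul_right, inner_smul_right,
      real_inner_smul_left, real_inner_smul_left, real_inner_self_eq_norm_sq, hν1, ← mul_sub,
      mul_eq_zero, or_iff_right hpos.ne', sub_eq_zero]
    simp
  ext x
  rw [Set.mem_inter_iff, SetLike.mem_coe, hmem]
  constructor
  · rintro ⟨hx, hx'⟩
    obtain ⟨z, hz, r, hr, rfl⟩ := (mem_hull_iff s k).1 hx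
    rw [add_sub_cancel_left, real_inner_smul_left, inner_normal_of_mem_faceHull hν hz] at hx'
    have hrt : r = t := mul_right_cancel₀ hpos.ne' hx'
    subst hrt
    rw [if_pos hr]
    exact ⟨z, hz, by simp [AffineMap.homothety_apply, add_comm]⟩
  · split_ifs with ht
    · rintro ⟨z, hz, rfl⟩
      refine ⟨(mem_hull_iff s k).2 ⟨z, hz, t, ht, ?_⟩, ?_⟩
      · simp [AffineMap.homothety_apply, add_comm]
      · simp only [AffineMap.homothety_apply, vsub_eq_sub, vadd_eq_add, add_sub_cancel_right]
        rw [real_inner_smul_left, inner_normal_of_mem_faceHull hν hz]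
    · simp

/-- The volume of a simplex in terms of the area of a face and the height over it. -/
theorem volume_hull_eq [NeZero d] (k : Fin (d + 1)) :
    volume (hull s) = ENNReal.ofReal (height s k / d) * μHE[d - 1] (faceHull s k) := by
  obtain ⟨ν, hν1, hν⟩ := exists_unit_normal s k
  have hpos := height_pos s k
  have hd : 0 < d := Nat.pos_of_ne_zero (NeZero.ne d)
  have hv : height s k • ν ≠ 0 := by
    rw [← norm_ne_zero_iff, norm_smul, hν1]
    simp [hpos.ne']
  have hvn : ‖height s k • ν‖ₑ = ENNReal.ofReal (height s k) := by
    rw [← ofReal_norm, norm_smul, hν1, mul_one, Real.norm_of_nonneg hpos.le]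
  have h := EuclideanGeometry.euclideanHausdorffMeasure_eq_lintegral (s.points k) hv
    (measurableSet_hull s)
  rw [finrank_euclideanSpace_fin, EuclideanSpace.euclideanHausdorffMeasure_eq_volume, hvn] at h
  rw [h, div_eq_mul_inv, ENNReal.ofReal_mul hpos.le, mul_assoc]
  congr 1
  -- Cavalieri's principle: the section at relative height `t` is the face shrunk by the factor `t`,
  -- of area `t^(d-1)` times that of the face, and these powers integrate to `1/d`. The degenerate
  -- section `t = 0` is a null set of parameters.
  have hsec : ∀ᵐ t : ℝ, μHE[d - 1] (hull s ∩
      AffineSubspace.mk' (t • (height s k • ν) +ᵥ s.points k) (ℝ ∙ (height s k • ν))ᗮ) =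
      (Set.Ioc (0 : ℝ) 1).indicator (fun t => ENNReal.ofReal (t ^ (d - 1))) t *
        μHE[d - 1] (faceHull s k) := by
    have h0 : ∀ᵐ t : ℝ, t ≠ 0 := by simp [ae_iff]
    filter_upwards [h0] with t ht
    rw [hull_inter_hyperplane s hν1 hν]
    by_cases hmem : t ∈ Set.Icc (0 : ℝ) 1
    · rw [if_pos hmem, euclideanHausdorffMeasure_homothety_image _ _ ht, Set.indicator_of_mem
        (show t ∈ Set.Ioc 0 1 from ⟨lt_of_le_of_ne hmem.1 ht.symm, hmem.2⟩), ENNReal.smul_def, smul_eq_mul]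
      congr 1
      rw [ENNReal.ofReal_pow hmem.1, ← Real.enorm_of_nonneg hmem.1, ENNReal.coe_pow]
      rfl
    · rw [if_neg hmem, Set.indicator_of_notMem (fun h => hmem ⟨h.1.le, h.2⟩)]
      simp
  rw [lintegral_congr_ae hsec, lintegral_mul_const _ ?_, lintegral_indicator measurableSet_Ioc,
    ← ofReal_integral_eq_lintegral_ofReal, ← intervalIntegral.integral_of_le zero_le_one,
    integral_pow]
  · congr 2
    obtain ⟨e, rfl⟩ : ∃ e, d = e + 1 := ⟨d - 1, by omega⟩
    simp
  · exact ((continuous_pow _).integrableOn_Icc).mono_set Set.Ioc_subset_Icc_self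
  · filter_upwards [ae_restrict_mem measurableSet_Ioc] with t ht
    exact pow_nonneg ht.1.le _
  · exact (by fun_prop : Measurable fun t : ℝ => ENNReal.ofReal (t ^ (d - 1))).indicator
      measurableSet_Ioc

end SimplexGeometry

/-! ### Simplices with a common face -/

section Overlap

variable {d : ℕ} {s s₁ s₂ s₃ : Affine.Simplex ℝ (Eu d) d} {k k₁ k₂ k₃ : Fin (d + 1)}

theorem map_eq_sum_coord (f : Eu d →ᵃ[ℝ] ℝ) (x : Eu d) :
    f x = ∑ j, (vertexBasis s).coord j x * f (s.points j) := by
  have h := (vertexBasis s).affineCombination_coord_eq_self x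
  have h1 := (vertexBasis s).sum_coord_apply_eq_one x
  conv_lhs => rw [← h]
  rw [Finset.map_affineCombination _ _ _ h1,
    Finset.affineCombination_eq_linear_combination _ _ _ h1]
  rfl

theorem coord_apply_face_eq_zero (h : s₁.points '' {k₁}ᶜ = s₂.points '' {k₂}ᶜ) {j : Fin (d + 1)}
    (hj : j ≠ k₂) : (vertexBasis s₁).coord k₁ (s₂.points j) = 0 := by
  obtain ⟨i, hi, hij⟩ : s₂.points j ∈ s₁.points '' {k₁}ᶜ := h ▸ ⟨j, hj, rfl⟩
  rw [← hij, ← vertexBasis_apply s₁, (vertexBasis s₁).coord_apply_ne (Ne.symm hi)]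

/-- The barycentric coordinates of two simplices with respect to a common face are
proportional. -/
theorem coord_eq_mul_coord (h : s₁.points '' {k₁}ᶜ = s₂.points '' {k₂}ᶜ) (x : Eu d) :
    (vertexBasis s₁).coord k₁ x =
      (vertexBasis s₂).coord k₂ x * (vertexBasis s₁).coord k₁ (s₂.points k₂) := by
  rw [map_eq_sum_coord (s := s₂) ((vertexBasis s₁).coord k₁) x, Finset.sum_eq_single k₂]
  · intro j _ hj
    rw [coord_apply_face_eq_zero h hj, mul_zero]
  · simp

/-- Two simplices with a common face overlap if they lie on the same side of this face. -/
theorem not_disjoint_interior_hull [NeZero d] (h : s₁.points '' {k₁}ᶜ = s₂.points '' {k₂}ᶜ)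
    (hpos : 0 < (vertexBasis s₁).coord k₁ (s₂.points k₂)) :
    ¬ Disjoint (interior (hull s₁)) (interior (hull s₂)) := by
  have hd : (0 : ℝ) < d := by exact_mod_cast Nat.pos_of_ne_zero (NeZero.ne d)
  -- The common interior point is the centroid of the shared face, moved slightly towards the apex
  -- of `s₂`. Its `s₁`-coordinate at the apex `k₁` is positive by `hpos`; the others are near `1/d`,
  -- hence positive for small `ε`.
  obtain ⟨ε, hε0, hε1, hε⟩ : ∃ ε : ℝ, 0 < ε ∧ ε < 1 ∧
      ∀ i, 0 < ε * (vertexBasis s₁).coord i (s₂.points k₂) + (1 - ε) / d := by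
    have hev : ∀ᶠ ε : ℝ in nhdsWithin 0 (Set.Ioi 0),
        ∀ i, 0 < ε * (vertexBasis s₁).coord i (s₂.points k₂) + (1 - ε) / d := by
      rw [Filter.eventually_all]
      intro i
      apply nhdsWithin_le_nhds
      have hc : ContinuousAt (fun ε : ℝ =>
          ε * (vertexBasis s₁).coord i (s₂.points k₂) + (1 - ε) / d) 0 := by fun_prop
      exact hc.eventually_const_lt (by simpa using hd)
    obtain ⟨ε, h1, h2⟩ := (hev.and (Ioo_mem_nhdsGT (zero_lt_one' ℝ))).exists
    exact ⟨ε, h2.1, h2.2, h1⟩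
  set w : Fin (d + 1) → ℝ := fun j => if j = k₂ then ε else (1 - ε) / d with hw
  have hwpos : ∀ j, 0 < w j := by
    intro j
    rw [hw]
    dsimp only
    split_ifs
    · exact hε0
    · exact div_pos (by linarith) hd
  have hsplit : ∀ g : Fin (d + 1) → ℝ, ∑ j, w j * g j =
      ε * g k₂ + (1 - ε) / d * ∑ j ∈ Finset.univ.erase k₂, g j := by
    intro g
    rw [← Finset.add_sum_erase _ _ (Finset.mem_univ k₂), Finset.mul_sum]
    congr 1
    · simp [hw]
    · refine Finset.sum_congr rfl fun j hj => ?_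
      simp [hw, (Finset.mem_erase.1 hj).1]
  have hw1 : ∑ j, w j = 1 := by
    have := hsplit fun _ => 1
    simp only [mul_one, Finset.sum_const, Finset.card_erase_of_mem (Finset.mem_univ k₂),
      Finset.card_univ, Fintype.card_fin, Nat.add_sub_cancel, nsmul_eq_mul] at this
    rw [this, div_mul_cancel₀ _ hd.ne']
    ring
  rw [Set.not_disjoint_iff]
  refine ⟨Finset.univ.affineCombination ℝ s₂.points w, ?_, ?_⟩
  · rw [interior_hull]
    intro i
    rw [Finset.map_affineCombination _ _ _ hw1,
      Finset.affineCombination_eq_linear_combination _ _ _ hw1]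
    simp only [Function.comp_apply, smul_eq_mul]
    rw [hsplit]
    have hmem : ∀ j ≠ k₂, ∃ i' ≠ k₁, s₁.points i' = s₂.points j := by
      intro j hj
      obtain ⟨i', hi', hij⟩ : s₂.points j ∈ s₁.points '' {k₁}ᶜ := h ▸ ⟨j, hj, rfl⟩
      exact ⟨i', hi', hij⟩
    have hnn : ∀ j ∈ Finset.univ.erase k₂, 0 ≤ (vertexBasis s₁).coord i (s₂.points j) := by
      intro j hj
      obtain ⟨i', -, hij⟩ := hmem j (Finset.mem_erase.1 hj).1
      rw [← hij, ← vertexBasis_apply s₁, AffineBasis.coord_apply]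
      split_ifs <;> norm_num
    have h1ε : 0 < (1 - ε) / d := div_pos (by linarith) hd
    by_cases hi : i = k₁
    · subst hi
      have := mul_nonneg h1ε.le (Finset.sum_nonneg hnn)
      have := mul_pos hε0 hpos
      linarith
    · obtain ⟨j, hj, hij⟩ : s₁.points i ∈ s₂.points '' {k₂}ᶜ := h ▸ ⟨i, hi, rfl⟩
      have hle := Finset.single_le_sum hnn (Finset.mem_erase.2 ⟨hj, Finset.mem_univ j⟩)
      rw [hij, ← vertexBasis_apply s₁, AffineBasis.coord_apply_eq] at hle
      have := mul_le_mul_of_nonneg_left hle h1ε.le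
      have := hε i
      linarith
  · rw [interior_hull]
    intro i
    have := (vertexBasis s₂).coord_apply_combination_of_mem (Finset.mem_univ i) hw1
    exact this ▸ hwpos i

/-- Three simplices with a common face overlap. -/
theorem not_three_disjoint_of_common_face [NeZero d] (h₂ : s₁.points '' {k₁}ᶜ = s₂.points '' {k₂}ᶜ)
    (h₃ : s₁.points '' {k₁}ᶜ = s₃.points '' {k₃}ᶜ)
    (h12 : Disjoint (interior (hull s₁)) (interior (hull s₂)))
    (h13 : Disjoint (interior (hull s₁)) (interior (hull s₃)))
    (h23 : Disjoint (interior (hull s₂)) (interior (hull s₃))) : False := by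
  have c12 : (vertexBasis s₁).coord k₁ (s₂.points k₂) ≤ 0 :=
    not_lt.1 fun h => not_disjoint_interior_hull h₂ h h12
  have c13 : (vertexBasis s₁).coord k₁ (s₃.points k₃) ≤ 0 :=
    not_lt.1 fun h => not_disjoint_interior_hull h₃ h h13
  have c23 : (vertexBasis s₂).coord k₂ (s₃.points k₃) ≤ 0 :=
    not_lt.1 fun h => not_disjoint_interior_hull (h₂.symm.trans h₃) h h23
  -- Each two apices lie on opposite sides of the face, which is impossible for three: a product of
  -- two nonpositive coordinates would be nonpositive as well, hence zero, and `e1` excludes zero.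
  have e3 := coord_eq_mul_coord h₂ (s₃.points k₃)
  have e1 := coord_eq_mul_coord h₃ (s₁.points k₁)
  rw [← vertexBasis_apply s₁, AffineBasis.coord_apply_eq] at e1
  have hne : (vertexBasis s₁).coord k₁ (s₃.points k₃) ≠ 0 := by
    intro h
    rw [h, mul_zero] at e1
    exact one_ne_zero e1
  have := mul_nonneg_of_nonpos_of_nonpos c23 c12
  exact hne (le_antisymm c13 (e3 ▸ this))

theorem aedisjoint_hull (h : Disjoint (interior (hull s₁)) (interior (hull s₂))) :
    AEDisjoint volume (hull s₁) (hull s₂) := by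
  have hf : ∀ s : Affine.Simplex ℝ (Eu d) d, hull s =ᵐ[volume] interior (hull s) := fun s =>
    (interior_ae_eq_of_null_frontier ((convex_convexHull ℝ _).addHaar_frontier volume)).symm
  exact h.aedisjoint.congr (hf s₁) (hf s₂)

end Overlap

/-- The measures of the pieces of a set add up. -/
theorem sum_measureReal_inter {α ι : Type*} [MeasurableSpace α] {μ : Measure α} {V : Set α}
    (hV : μ V ≠ ⊤) (hVm : MeasurableSet V) (F : Finset ι) {A : ι → Set α}
    (hA : ∀ i ∈ F, MeasurableSet (A i))
    (hd : ∀ i ∈ F, ∀ j ∈ F, i ≠ j → AEDisjoint μ (A i) (A j)) (hcov : V ⊆ ⋃ i ∈ F, A i) :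
    ∑ i ∈ F, μ.real (V ∩ A i) = μ.real V := by
  have h : μ V = ∑ i ∈ F, μ (V ∩ A i) := by
    rw [← measure_biUnion_finset₀, ← Set.inter_iUnion₂, Set.inter_eq_self_of_subset_left hcov]
    · intro i hi j hj hij
      exact (hd i hi j hj hij).mono Set.inter_subset_right Set.inter_subset_right
    · exact fun i hi => (hVm.inter (hA i hi)).nullMeasurableSet
  rw [Measure.real, h, ENNReal.toReal_sum]
  · rfl
  · exact fun i _ => ne_top_of_le_ne_top hV (measure_mono Set.inter_subset_left)

/-! ### Injectivity of the transpose of the divergence operator -/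

namespace Grid

variable {n : ℕ} {M : Grid n}

theorem faceSet_eq (f : M.Face) :
    M.faceSet f = M.chart (M.sub f.1) '' faceHull (M.simplex f.1) f.2 :=
  ((M.chart (M.sub f.1)).toAffineMap.image_convexHull _).symm

variable (M) in
/-- The area of a face. -/
def faceArea (f : M.Face) : ℝ := (μHE[M.cdim f.1 - 1] (M.faceSet f)).toReal

theorem height_mul_faceArea (f : M.Face) (h : 0 < M.cdim f.1) :
    height (M.simplex f.1) f.2 * M.faceArea f =
      M.cdim f.1 * volume.real (hull (M.simplex f.1)) := by
  have : NeZero (M.dim (M.sub f.1)) := ⟨h.ne'⟩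
  have hpos := height_pos (M.simplex f.1) f.2
  have hd : (0 : ℝ) < M.cdim f.1 := by exact_mod_cast h
  rw [Measure.real, volume_hull_eq (M.simplex f.1) f.2, ENNReal.toReal_mul, faceArea, faceSet_eq,
    (M.chart (M.sub f.1)).isometry.euclideanHausdorffMeasure_image,
    ENNReal.toReal_ofReal (by positivity)]
  change _ = _ * (height (M.simplex f.1) f.2 / (M.cdim f.1 : ℝ) * _)
  field_simp
  rfl

theorem faceArea_pos (f : M.Face) (h : 0 < M.cdim f.1) : 0 < M.faceArea f := by
  have : NeZero (M.dim (M.sub f.1)) := ⟨h.ne'⟩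
  refine pos_of_mul_pos_right ?_ (height_pos (M.simplex f.1) f.2).le
  rw [height_mul_faceArea f h]
  exact mul_pos (by exact_mod_cast h) (volume_real_hull_pos _)

theorem divergence_field (T : M.Cell) (c : M.Face → ℝ) (x : Eu (M.dim (M.sub T))) :
    divergence (M.field T c) x = M.cdim T * ∑ k, c ⟨T, k⟩ * (height (M.simplex T) k)⁻¹ := by
  have h : HasFDerivAt (M.field T c)
      (∑ k, c ⟨T, k⟩ • (height (M.simplex T) k)⁻¹ •
        ContinuousLinearMap.id ℝ (Eu (M.dim (M.sub T)))) x :=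
    HasFDerivAt.fun_sum fun k _ =>
      (((hasFDerivAt_id x).sub_const (M.simplex T |>.points k)).const_smul
        (height (M.simplex T) k)⁻¹).const_smul (c ⟨T, k⟩)
  rw [divergence, h.fderiv, Finset.mul_sum]
  simp only [ContinuousLinearMap.toLinearMap_sum, map_sum]
  refine Finset.sum_congr rfl fun k _ => ?_
  simp [cdim]
  ring

/-- The divergence theorem on each element. It follows from the constant divergence of the basis
functions and the relation between volume, height and face area. -/
theorem divForm_apply (c : M.Face → ℝ) (p : M.Q) :
    M.divForm c p = ∑ f : M.Face, p f.1 * c f * M.faceArea f := by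
  rw [Fintype.sum_sigma]
  change ∑ T, ∫ x in hull (M.simplex T), p T * divergence (M.field T c) x = _
  refine Finset.sum_congr rfl fun T _ => ?_
  simp only [divergence_field, setIntegral_const, smul_eq_mul]
  rw [Finset.mul_sum, Finset.mul_sum, Finset.mul_sum]
  refine Finset.sum_congr rfl fun k _ => ?_
  rcases Nat.eq_zero_or_pos (M.cdim T) with h0 | h0
  -- A point element has one formal face, which is the empty set; both sides vanish.
  · have : M.faceArea ⟨T, k⟩ = 0 := by
      have hk : ({k}ᶜ : Set (Fin (M.dim (M.sub T) + 1))) = ∅ := by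
        have hs : Subsingleton (Fin (M.dim (M.sub T) + 1)) := by
          rw [show M.dim (M.sub T) = 0 from h0]
          exact inferInstanceAs (Subsingleton (Fin 1))
        ext j
        simp [Subsingleton.elim j k]
      simp [faceArea, faceSet, faceVerts, hk]
    rw [this, h0]
    simp
  · have : NeZero (M.dim (M.sub T)) := ⟨h0.ne'⟩
    have hpos := height_pos (M.simplex T) k
    have := height_mul_faceArea ⟨T, k⟩ h0
    simp only at this
    field_simp
    linear_combination -(p T * c ⟨T, k⟩) * this

theorem Glued.symm {f g : M.Face} (h : M.Glued f g) : M.Glued g f :=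
  ⟨h.1.symm, h.2.1.symm, h.2.2.1.symm, h.2.2.2.2, h.2.2.2.1⟩

theorem Glued.faceArea_eq {f g : M.Face} (h : M.Glued f g) : M.faceArea f = M.faceArea g := by
  have hd : M.cdim f.1 = M.cdim g.1 := congrArg M.dim h.2.1
  rw [faceArea, faceArea, faceSet, faceSet, h.2.2.1, hd]

/-- Transports an element along the equality of subdomains, so that several elements of one
subdomain can be compared in a single coordinate space. -/
theorem exists_simplex_coordinates (f : M.Face) {i : M.Sub} (h : M.sub f.1 = i) :
    ∃ (s : Affine.Simplex ℝ (Eu (M.dim i)) (M.dim i)) (k : Fin (M.dim i + 1)),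
      M.openCell f.1 = M.chart i '' interior (hull s) ∧
      M.closedCell f.1 = M.chart i '' hull s ∧
      M.faceVerts f = M.chart i '' (s.points '' {k}ᶜ) := by
  subst h
  exact ⟨M.simplex f.1, f.2, rfl, rfl, rfl⟩

/-- In dimension zero, two elements of the same subdomain would be the same point and overlap. -/
theorem Glued.cdim_pos (hM : M.IsAdmissible) {f g : M.Face} (h : M.Glued f g) :
    0 < M.cdim f.1 := by
  by_contra h0
  have h0 : M.dim (M.sub f.1) = 0 := Nat.eq_zero_of_not_pos h0
  have hs : Subsingleton (Eu (M.dim (M.sub f.1))) := by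
    rw [h0]; infer_instance
  obtain ⟨s, -, hs1, -, -⟩ := exists_simplex_coordinates f rfl
  obtain ⟨t, -, ht1, -, -⟩ := exists_simplex_coordinates g h.2.1.symm
  have hd := hM.disjoint_cells _ _ h.1
  rw [hs1, ht1, Set.disjoint_image_iff (M.chart _).injective] at hd
  obtain ⟨x, hx⟩ := interior_hull_nonempty s
  obtain ⟨y, hy⟩ := interior_hull_nonempty t
  exact Set.disjoint_left.1 hd hx (Subsingleton.elim y x ▸ hy)

/-- A face of an element is glued to at most one other face. -/
theorem Glued.unique (hM : M.IsAdmissible) {f g g' : M.Face} (h : M.Glued f g)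
    (h' : M.Glued f g') : g = g' := by
  have : NeZero (M.dim (M.sub f.1)) := ⟨(h.cdim_pos hM).ne'⟩
  have hinj := (M.chart (M.sub f.1)).injective
  by_cases hc : g.1 = g'.1
  · obtain ⟨T, k⟩ := g
    obtain ⟨T', k'⟩ := g'
    dsimp only at hc
    subst hc
    have e := h.2.2.1.symm.trans h'.2.2.1
    rw [faceVerts, faceVerts] at e
    have e1 := (M.simplex T).independent.injective.image_injective
      ((M.chart (M.sub T)).injective.image_injective e)
    rw [compl_inj_iff, Set.singleton_eq_singleton_iff] at e1
    exact congrArg (Sigma.mk T) e1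
  · obtain ⟨s, k, ho, -, hv⟩ := exists_simplex_coordinates f rfl
    obtain ⟨s₁, k₁, ho₁, -, hv₁⟩ := exists_simplex_coordinates g h.2.1.symm
    obtain ⟨s₂, k₂, ho₂, -, hv₂⟩ := exists_simplex_coordinates g' h'.2.1.symm
    have d1 := hM.disjoint_cells _ _ h.1
    have d2 := hM.disjoint_cells _ _ h'.1
    have d3 := hM.disjoint_cells _ _ hc
    rw [ho, ho₁, Set.disjoint_image_iff hinj] at d1
    rw [ho, ho₂, Set.disjoint_image_iff hinj] at d2
    rw [ho₁, ho₂, Set.disjoint_image_iff hinj] at d3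
    exact (not_three_disjoint_of_common_face
      (hinj.image_injective (hv.symm.trans (h.2.2.1.trans hv₁)))
      (hinj.image_injective (hv.symm.trans (h'.2.2.1.trans hv₂))) d1 d2 d3).elim

variable {p : M.Q}

theorem divForm_eq_zero (hp : M.opB.flip p = 0) {c : M.Face → ℝ} (hc : c ∈ M.fluxSpace₀) :
    ∑ f : M.Face, p f.1 * c f * M.faceArea f = 0 := by
  have h : M.opB.flip p (⟨c, hc⟩, 0) = 0 := by rw [hp]; rfl
  have h2 : M.opB.flip p (⟨c, hc⟩, 0) = -M.divForm c p := by
    simp [opB, totalFlux]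
  rw [← divForm_apply]
  linarith

-- The test flux carries one unit out of one element and into the other. It belongs to `fluxSpace₀`
-- because neither face is glued to a third one, and the two contributions have equal areas.
open Classical in
theorem eq_of_glued (hM : M.IsAdmissible) (hp : M.opB.flip p = 0) {f g : M.Face}
    (h : M.Glued f g) : p f.1 = p g.1 := by
  have hfg : f ≠ g := fun e => h.1 (by rw [e])
  have hne : ∀ f' g', M.Glued f' g' → f' ≠ f → f' ≠ g → g' ≠ f ∧ g' ≠ g := by
    intro f' g' h' h1 h2
    exact ⟨fun e => h2 ((e ▸ h'.symm).unique hM h), fun e => h1 ((e ▸ h'.symm).unique hM h.symm)⟩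
  have hc : (Pi.single f 1 - Pi.single g 1 : M.Face → ℝ) ∈ M.fluxSpace₀ := by
    have hz : ∀ f', f' ≠ f → f' ≠ g → (Pi.single f 1 - Pi.single g 1 : M.Face → ℝ) f' = 0 := by
      intro f' h1 h2
      simp [h1, h2]
    refine ⟨⟨fun f' g' h' => ?_, fun f' h' => ?_, fun f' h' => ?_⟩, fun f' h' => ?_⟩
    · by_cases h1 : f' = f
      · subst h1
        obtain rfl := h.unique hM h'
        simp [hfg, hfg.symm]
      · by_cases h2 : f' = g
        · subst h2
          obtain rfl := h.symm.unique hM h'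
          simp [hfg, hfg.symm]
        · rw [hz f' h1 h2, hz g' (hne f' g' h' h1 h2).1 (hne f' g' h' h1 h2).2, add_zero]
    · refine hz f' (fun e => ?_) (fun e => ?_)
      · exact (hM.neumann_boundary f' h').2.2 g (e ▸ h)
      · exact (hM.neumann_boundary f' h').2.2 f (e ▸ h.symm)
    · refine hz f' (fun e => ?_) (fun e => ?_)
      · exact (h.cdim_pos hM).ne' (e ▸ h')
      · exact (h.symm.cdim_pos hM).ne' (e ▸ h')
    · refine hz f' (fun e => ?_) (fun e => ?_)
      · exact h' (e ▸ h.2.2.2.1)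
      · exact h' (e ▸ h.2.2.2.2)
  have h0 := divForm_eq_zero hp hc
  simp only [Pi.sub_apply, mul_sub, sub_mul, Finset.sum_sub_distrib, Pi.single_apply, mul_ite,
    ite_mul, mul_one, mul_zero, zero_mul, Finset.sum_ite_eq', Finset.mem_univ, if_true] at h0
  rw [← h.faceArea_eq, ← sub_mul] at h0
  exact sub_eq_zero.1 ((mul_eq_zero.1 h0).resolve_right (faceArea_pos f (h.cdim_pos hM)).ne')

theorem eq_of_sub_eq (hM : M.IsAdmissible) (hp : M.opB.flip p = 0) {S T : M.Cell}
    (h : M.sub S = M.sub T) : p S = p T := by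
  induction hM.connected_sub S T h with
  | refl => rfl
  | @tail T' T'' h1 h2 ih =>
    obtain ⟨f, g, rfl, rfl, hfg⟩ := h2
    have hsub : M.sub g.1 = M.sub f.1 := hfg.2.1.symm
    rw [ih (h.trans hsub), eq_of_glued hM hp hfg]

-- A boundary face outside the Neumann part is subject to no constraint of `fluxSpace₀`, so the unit
-- flux through it alone is a test function.
open Classical in
theorem eq_zero_of_dirichlet (hp : M.opB.flip p = 0) {f : M.Face} (hb : M.IsBoundary f)
    (hf : f ∉ M.neumann) : p f.1 = 0 := by
  have hc : (Pi.single f 1 : M.Face → ℝ) ∈ M.fluxSpace₀ := by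
    have hz : ∀ f', f' ≠ f → (Pi.single f 1 : M.Face → ℝ) f' = 0 := fun f' h1 => by simp [h1]
    refine ⟨⟨fun f' g' h' => ?_, fun f' h' => ?_, fun f' h' => ?_⟩, fun f' h' => ?_⟩
    · rw [hz f' fun e => hb.2.2 g' (e ▸ h'), hz g' fun e => hb.2.2 f' (e ▸ h'.symm), add_zero]
    · exact hz f' fun e => hf (e ▸ h')
    · exact hz f' fun e => hb.1.ne' (e ▸ h')
    · exact hz f' fun e => h' (e ▸ hb.2.1)
  have h0 := divForm_eq_zero hp hc
  simp only [Pi.single_apply, mul_ite, ite_mul, mul_one, mul_zero, zero_mul, Finset.sum_ite_eq',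
    Finset.mem_univ, if_true] at h0
  exact (mul_eq_zero.1 h0).resolve_right (faceArea_pos f hb.1).ne'

theorem isCompact_faceSet (f : M.Face) : IsCompact (M.faceSet f) :=
  (((Set.toFinite _).image _).image _).isCompact_convexHull ℝ

theorem isCompact_closedCell (T : M.Cell) : IsCompact (M.closedCell T) :=
  (isCompact_hull _).image (M.chart _).continuous

theorem faceSet_subset_range (hM : M.IsAdmissible) {f : M.Face} {j : M.Ifc}
    (h : M.faceIfc f = some j) : M.faceSet f ⊆ Set.range (M.chart (M.lower j)) := by
  have h1 : M.faceSet f ⊆ M.ifcSet j := by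
    rw [hM.ifcSet_faces]
    exact Set.subset_iUnion₂ (s := fun f (_ : M.faceIfc f = some j) => M.faceSet f) f h
  refine h1.trans (Set.iUnion₂_subset fun m hm => ?_)
  subst hm
  exact Set.image_subset_range _ _

/-- Identifies the denominator of `proj`, measured in the chart of the lower subdomain, with the
area seen from the upper element: charts are isometries and Hausdorff measure is intrinsic. -/
theorem volume_preimage_faceSet (hM : M.IsAdmissible) {f : M.Face} {j : M.Ifc}
    (h : M.faceIfc f = some j) :
    volume.real (M.chart (M.lower j) ⁻¹' M.faceSet f) = M.faceArea f := by
  have hd : M.cdim f.1 - 1 = M.dim (M.lower j) := by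
    rw [cdim, hM.faceIfc_upper f j h, hM.dim_upper, Nat.add_sub_cancel]
  rw [Measure.real, ← EuclideanSpace.euclideanHausdorffMeasure_eq_volume,
    (M.chart (M.lower j)).isometry.euclideanHausdorffMeasure_preimage,
    Set.inter_eq_self_of_subset_left (faceSet_subset_range hM h), faceArea, hd]

theorem faceIfc_cdim_pos (hM : M.IsAdmissible) {f : M.Face} {j : M.Ifc}
    (h : M.faceIfc f = some j) : 0 < M.cdim f.1 := by
  rw [cdim, hM.faceIfc_upper f j h, hM.dim_upper]
  exact Nat.succ_pos _

open Classical in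
theorem sum_volume_mortar_inter_face (hM : M.IsAdmissible) (m : M.Mortar) :
    ∑ f : M.Face with M.faceIfc f = some (M.ifc m),
      volume.real (hull (M.mortarSimplex m) ∩ M.chart (M.lower (M.ifc m)) ⁻¹' M.faceSet f) =
    volume.real (hull (M.mortarSimplex m)) := by
  apply sum_measureReal_inter (volume_hull_ne_top _) (measurableSet_hull _)
  · exact fun f _ => (M.chart _).continuous.measurable (isCompact_faceSet f).measurableSet
  · intro f hf g hg hfg
    exact hM.faces_overlap _ f g (Finset.mem_filter.1 hf).2 (Finset.mem_filter.1 hg).2 hfg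
  · intro x hx
    have h1 : M.chart (M.lower (M.ifc m)) x ∈ M.ifcSet (M.ifc m) :=
      Set.mem_iUnion₂.2 ⟨m, rfl, Set.mem_image_of_mem _ hx⟩
    rw [hM.ifcSet_faces] at h1
    obtain ⟨f, hf, hxf⟩ := Set.mem_iUnion₂.1 h1
    exact Set.mem_iUnion₂.2 ⟨f, Finset.mem_filter.2 ⟨Finset.mem_univ _, hf⟩, hxf⟩

open Classical in
theorem sum_volume_mortar_inter_cell (hM : M.IsAdmissible) (m : M.Mortar) :
    ∑ C : M.Cell with M.sub C = M.lower (M.ifc m),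
      volume.real (hull (M.mortarSimplex m) ∩ M.chart (M.lower (M.ifc m)) ⁻¹' M.closedCell C) =
    volume.real (hull (M.mortarSimplex m)) := by
  apply sum_measureReal_inter (volume_hull_ne_top _) (measurableSet_hull _)
  · exact fun f _ => (M.chart _).continuous.measurable (isCompact_closedCell f).measurableSet
  · intro C hC D hD hne
    have hinj := (M.chart (M.lower (M.ifc m))).injective
    obtain ⟨s, -, ho, hc, -⟩ := exists_simplex_coordinates ⟨C, 0⟩ (Finset.mem_filter.1 hC).2
    obtain ⟨t, -, ho', hc', -⟩ := exists_simplex_coordinates ⟨D, 0⟩ (Finset.mem_filter.1 hD).2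
    have hd := hM.disjoint_cells _ _ hne
    dsimp only at ho hc ho' hc'
    rw [ho, ho', Set.disjoint_image_iff hinj] at hd
    rw [hc, hc', Set.preimage_image_eq _ hinj, Set.preimage_image_eq _ hinj]
    exact aedisjoint_hull hd
  · intro x hx
    have h1 : M.chart (M.lower (M.ifc m)) x ∈ M.ifcSet (M.ifc m) :=
      Set.mem_iUnion₂.2 ⟨m, rfl, Set.mem_image_of_mem _ hx⟩
    obtain ⟨C, hC, hxC⟩ := Set.mem_iUnion₂.1 (hM.ifcSet_lower _ h1)
    exact Set.mem_iUnion₂.2 ⟨C, Finset.mem_filter.2 ⟨Finset.mem_univ _, hC⟩, hxC⟩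

-- The test function is the indicator of one mortar element. Face-wise averaging preserves its
-- integral, because the faces tile the interface, so the upper and lower values are weighted by the
-- same positive volume with opposite signs.
open Classical in
theorem eq_of_interface (hM : M.IsAdmissible) (hp : M.opB.flip p = 0) {q : M.Sub → ℝ}
    (hq : ∀ T, p T = q (M.sub T)) (j : M.Ifc) : q (M.lower j) = q (M.upper j) := by
  obtain ⟨m, rfl⟩ := hM.mortar_nonempty j
  have h : M.opB.flip p (0, Pi.single m 1) = 0 := by rw [hp]; rfl
  have h2 : M.opB.flip p (0, Pi.single m 1) =
      -(M.divForm (M.ext (Pi.single m 1)) p + M.jumpForm (Pi.single m 1) p) := by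
    simp [opB, totalFlux]
  have hjump : M.jumpForm (Pi.single m 1) p =
      -(q (M.lower (M.ifc m)) * volume.real (hull (M.mortarSimplex m))) := by
    change -∑ m', ∑ C : M.Cell with M.sub C = M.lower (M.ifc m'), (Pi.single m 1 : M.Mortar → ℝ) m' *
      p C * volume.real (hull (M.mortarSimplex m') ∩
        M.chart (M.lower (M.ifc m')) ⁻¹' M.closedCell C) = _
    rw [Finset.sum_eq_single m]
    · rw [← sum_volume_mortar_inter_cell hM m, Finset.mul_sum]
      congr 1
      refine Finset.sum_congr rfl fun C hC => ?_
      rw [Pi.single_eq_same, one_mul, hq, (Finset.mem_filter.1 hC).2]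
    · intro m' _ hm'
      simp [hm']
    · simp
  have hdiv : M.divForm (M.ext (Pi.single m 1)) p =
      q (M.upper (M.ifc m)) * volume.real (hull (M.mortarSimplex m)) := by
    rw [divForm_apply, ← sum_volume_mortar_inter_face hM m, Finset.mul_sum, Finset.sum_filter]
    refine Finset.sum_congr rfl fun f _ => ?_
    change p f.1 * ((M.faceIfc f).elim 0 fun j => M.proj j f (Pi.single m 1)) * _ = _
    rcases hf : M.faceIfc f with _ | j
    · simp
    · simp only [Option.elim_some, Option.some.injEq, proj]
      by_cases hj : j = M.ifc m
      · subst hj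
        have hA := faceArea_pos f (faceIfc_cdim_pos hM hf)
        rw [volume_preimage_faceSet hM hf, Finset.sum_eq_single m, if_pos rfl, hq,
          hM.faceIfc_upper f _ hf]
        · simp only [Pi.single_eq_same, one_mul]
          field_simp
        · intro m' _ hm'
          simp [hm']
        · simp
      · rw [if_neg hj, Finset.sum_eq_zero]
        · simp
        · intro m' hm'
          have : m' ≠ m := fun e => hj (e ▸ (Finset.mem_filter.1 hm').2.symm)
          simp [this]
  rw [hjump, hdiv] at h2
  have h3 : (q (M.upper (M.ifc m)) - q (M.lower (M.ifc m))) *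
      volume.real (hull (M.mortarSimplex m)) = 0 := by linarith
  linarith [(mul_eq_zero.1 h3).resolve_right (volume_real_hull_pos _).ne']

/-- The divergence operator of a connected medium with a Dirichlet boundary is surjective. -/
theorem opB_flip_injective (hM : M.IsAdmissible) : Function.Injective M.opB.flip := by
  classical
  rw [injective_iff_map_eq_zero]
  intro p hp
  -- The value `0` is a default for subdomains without elements.
  let q : M.Sub → ℝ := fun i => if h : ∃ C, M.sub C = i then p h.choose else 0
  have hq : ∀ T, p T = q (M.sub T) := by
    intro T
    have h : ∃ C, M.sub C = M.sub T := ⟨T, rfl⟩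
    simp only [q, dif_pos h]
    exact eq_of_sub_eq hM hp h.choose_spec.symm
  have hconst : ∀ i i', q i = q i' := by
    intro i i'
    induction hM.connected i i' with
    | rel a c h =>
      obtain ⟨j, rfl, rfl⟩ := h
      exact eq_of_interface hM hp hq j
    | refl => rfl
    | symm _ _ _ ih => exact ih.symm
    | trans _ _ _ _ _ ih ih' => exact ih.trans ih'
  obtain ⟨f, -, hb, hf⟩ := hM.dirichlet
  funext T
  rw [hq, hconst _ (M.sub f.1), ← hq, eq_zero_of_dirichlet hp hb hf]
  rfl

end Grid

/-! ### Quadratic forms of the permeability and of its inverse -/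

section Quadratic

variable {d : ℕ}

theorem inner_toEuclideanLin_comm {K : Matrix (Fin d) (Fin d) ℝ} (hK : K.PosDef) (u v : Eu d) :
    inner ℝ (Matrix.toEuclideanLin K u) v = inner ℝ (Matrix.toEuclideanLin K v) u := by
  rw [Matrix.isSymmetric_toEuclideanLin_iff.2 hK.isHermitian u v, real_inner_comm]

theorem inner_toEuclideanLin_pos {K : Matrix (Fin d) (Fin d) ℝ} (hK : K.PosDef) {v : Eu d}
    (hv : v ≠ 0) : 0 < inner ℝ (Matrix.toEuclideanLin K v) v := by
  have h := hK.dotProduct_mulVec_pos (x := v.ofLp) (by simpa using hv)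
  rw [EuclideanSpace.inner_eq_star_dotProduct, Matrix.ofLp_toLpLin, Matrix.toLin'_apply]
  simpa [dotProduct_comm] using h

theorem inner_toEuclideanLin_nonneg {K : Matrix (Fin d) (Fin d) ℝ} (hK : K.PosDef) (v : Eu d) :
    0 ≤ inner ℝ (Matrix.toEuclideanLin K v) v := by
  rcases eq_or_ne v 0 with rfl | hv
  · simp
  · exact (inner_toEuclideanLin_pos hK hv).le

theorem toEuclideanLin_mul_inv {K : Matrix (Fin d) (Fin d) ℝ} (hK : K.PosDef) (v : Eu d) :
    Matrix.toEuclideanLin K (Matrix.toEuclideanLin K⁻¹ v) = v := by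
  have hu : IsUnit K.det := (Matrix.isUnit_iff_isUnit_det K).1 hK.isUnit
  rw [Matrix.toLpLin_apply, Matrix.toLpLin_apply]
  simp [Matrix.mulVec_mulVec, Matrix.mul_nonsing_inv K hu]

theorem inner_toEuclideanLin_sq_le {K : Matrix (Fin d) (Fin d) ℝ} (hK : K.PosDef) (u v : Eu d) :
    inner ℝ (Matrix.toEuclideanLin K u) v ^ 2 ≤
      inner ℝ (Matrix.toEuclideanLin K u) u * inner ℝ (Matrix.toEuclideanLin K v) v := by
  set A : Eu d →ₗ[ℝ] Module.Dual ℝ (Eu d) := LinearMap.mk₂ ℝ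
    (fun u v => inner ℝ (Matrix.toEuclideanLin K u) v)
    (fun a b c => by simp [inner_add_left]) (fun r a b => by simp [real_inner_smul_left])
    (fun a b c => by simp [inner_add_right]) (fun r a b => by simp [real_inner_smul_right])
  have hA : IsSPD A := ⟨inner_toEuclideanLin_comm hK, fun v hv => inner_toEuclideanLin_pos hK hv⟩
  exact hA.sq_le u v

/-- The anisotropy of the inverse of a tensor is at most the anisotropy of the tensor. -/
theorem anisotropy_inv {K : Matrix (Fin d) (Fin d) ℝ} (hK : K.PosDef) {κ : ℝ}
    (h : ∀ u v : Eu d, inner ℝ (Matrix.toEuclideanLin K u) u * ‖v‖ ^ 2 ≤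
      κ * inner ℝ (Matrix.toEuclideanLin K v) v * ‖u‖ ^ 2) (u v : Eu d) :
    inner ℝ (Matrix.toEuclideanLin K⁻¹ u) u * ‖v‖ ^ 2 ≤
      κ * inner ℝ (Matrix.toEuclideanLin K⁻¹ v) v * ‖u‖ ^ 2 := by
  rcases eq_or_ne u 0 with rfl | hu
  · simp
  rcases eq_or_ne v 0 with rfl | hv
  · simp
  set x := Matrix.toEuclideanLin K⁻¹ u with hx
  set y := Matrix.toEuclideanLin K⁻¹ v with hy
  have hKx : Matrix.toEuclideanLin K x = u := toEuclideanLin_mul_inv hK u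
  have hKy : Matrix.toEuclideanLin K y = v := toEuclideanLin_mul_inv hK v
  have hx0 : x ≠ 0 := fun e => hu (by rw [← hKx, e, map_zero])
  have hy0 : y ≠ 0 := fun e => hv (by rw [← hKy, e, map_zero])
  have hpx := inner_toEuclideanLin_pos hK hx0
  have hpy := inner_toEuclideanLin_pos hK hy0
  have hpv := inner_toEuclideanLin_pos hK hv
  rw [hKx, real_inner_comm] at hpx
  rw [hKy, real_inner_comm] at hpy
  have hnu : 0 < ‖u‖ ^ 2 := by positivity
  have hnv : 0 < ‖v‖ ^ 2 := by positivity
  have hnx : 0 < ‖x‖ ^ 2 := by positivity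
  -- the Cauchy-Schwarz inequalities for `K` and for the identity
  have h1 := inner_toEuclideanLin_sq_le hK y v
  rw [hKy, real_inner_self_eq_norm_sq, real_inner_comm] at h1
  have h2 : inner ℝ x u ^ 2 ≤ ‖x‖ ^ 2 * ‖u‖ ^ 2 := by
    rw [← mul_pow, sq_le_sq₀ hpx.le (by positivity)]
    exact real_inner_le_norm x u
  have h3 := h v x
  rw [hKx, real_inner_comm x u] at h3
  have hκ : 0 < κ := by
    have := h v v
    have h5 : 0 < inner ℝ (Matrix.toEuclideanLin K v) v * ‖v‖ ^ 2 := mul_pos hpv hnv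
    nlinarith
  set a := inner ℝ x u
  set b := inner ℝ y v
  set r := inner ℝ (Matrix.toEuclideanLin K v) v
  -- `‖v‖⁴ ≤ b r`, `a² ≤ ‖x‖² ‖u‖²`, `r ‖x‖² ≤ κ a ‖v‖²`
  have h4 : (a * ‖v‖ ^ 2) * (a * ‖v‖ ^ 2 * ‖x‖ ^ 2) ≤
      (κ * b * ‖u‖ ^ 2) * (a * ‖v‖ ^ 2 * ‖x‖ ^ 2) := by
    calc (a * ‖v‖ ^ 2) * (a * ‖v‖ ^ 2 * ‖x‖ ^ 2)
        = a ^ 2 * ((‖v‖ ^ 2) ^ 2) * ‖x‖ ^ 2 := by ring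
      _ ≤ a ^ 2 * (b * r) * ‖x‖ ^ 2 := by gcongr
      _ = a ^ 2 * b * (r * ‖x‖ ^ 2) := by ring
      _ ≤ a ^ 2 * b * (κ * a * ‖v‖ ^ 2) := by gcongr
      _ ≤ (‖x‖ ^ 2 * ‖u‖ ^ 2) * b * (κ * a * ‖v‖ ^ 2) := by gcongr
      _ = _ := by ring
  exact le_of_mul_le_mul_right h4 (by positivity)

/-- Each mixed term is at most the mean of the two diagonal ones, by positivity on `x i - x j`. Only
positivity of `K` matters, so the constant does not see the anisotropy. -/
theorem inner_sum_le {K : Matrix (Fin d) (Fin d) ℝ} (hK : K.PosDef) {ι : Type*} [Fintype ι]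
    (x : ι → Eu d) : inner ℝ (Matrix.toEuclideanLin K (∑ i, x i)) (∑ i, x i) ≤
      Fintype.card ι * ∑ i, inner ℝ (Matrix.toEuclideanLin K (x i)) (x i) := by
  have h : ∀ i j, inner ℝ (Matrix.toEuclideanLin K (x i)) (x j) ≤
      2⁻¹ * inner ℝ (Matrix.toEuclideanLin K (x i)) (x i) +
      2⁻¹ * inner ℝ (Matrix.toEuclideanLin K (x j)) (x j) := by
    intro i j
    have h0 := inner_toEuclideanLin_nonneg hK (x i - x j)
    rw [map_sub, inner_sub_left, inner_sub_right, inner_sub_right,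
      inner_toEuclideanLin_comm hK (x j) (x i)] at h0
    linarith
  simp only [map_sum, sum_inner, inner_sum]
  refine (Finset.sum_le_sum fun i _ => Finset.sum_le_sum fun j _ => h j i).trans_eq ?_
  simp only [Finset.sum_add_distrib, ← Finset.mul_sum, Finset.sum_const, Finset.card_univ,
    nsmul_eq_mul]
  ring

end Quadratic

/-! ### Raviart-Thomas functions on a shape-regular element -/

section Element

variable {d : ℕ} {s : Affine.Simplex ℝ (Eu d) d}

theorem continuous_rtBasis (k : Fin (d + 1)) : Continuous (rtBasis s k) := by
  unfold rtBasis
  fun_prop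

variable [NeZero d]

/-- The coefficients are the normal components on the faces. -/
theorem inner_normal_sum_rtBasis (a : Fin (d + 1) → ℝ) {k i : Fin (d + 1)} (hi : i ≠ k) {ν : Eu d}
    (hν : ∀ j, j ≠ k → inner ℝ (s.points j - s.points k) ν = height s k) :
    inner ℝ (∑ j, a j • rtBasis s j (s.points i)) ν = a k := by
  rw [sum_inner, Finset.sum_eq_single k]
  · rw [real_inner_smul_left, rtBasis, real_inner_smul_left, hν i hi,
      inv_mul_cancel₀ (height_pos s k).ne', mul_one]
  · intro j _ hj
    rw [real_inner_smul_left, rtBasis, real_inner_smul_left,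
      ← sub_sub_sub_cancel_right _ _ (s.points k), inner_sub_left, hν i hi, hν j hj]
    simp
  · simp

variable {c : Eu d} {ρ σ : ℝ}

/-- On some ball in the element, the size of a Raviart-Thomas function is bounded from below by
all of its degrees of freedom. -/
theorem exists_ball_abs_le_norm (hρ : 0 < ρ) (hball : Metric.closedBall c ρ ⊆ hull s)
    (hdiam : Metric.diam (hull s) ≤ σ * ρ) (a : Fin (d + 1) → ℝ) :
    ∃ c' : Eu d, Metric.closedBall c' (ρ / 4) ⊆ hull s ∧
      ∀ x ∈ Metric.closedBall c' (ρ / 4), ∀ k,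
        |a k| ≤ max 1 (4 * σ) * ‖∑ j, a j • rtBasis s j x‖ := by
  set u : Eu d → Eu d := fun x => ∑ j, a j • rtBasis s j x with hu
  set S : ℝ := ∑ j, a j * (height s j)⁻¹ with hS
  -- A Raviart-Thomas function is a constant plus a multiple of the position vector.
  have hlin : ∀ x y, u x = u y + S • (x - y) := by
    intro x y
    rw [hu, hS, Finset.sum_smul, ← Finset.sum_add_distrib]
    refine Finset.sum_congr rfl fun j _ => ?_
    rw [rtBasis, rtBasis, mul_smul, ← smul_add, ← smul_add]
    congr 2
    abel
  obtain ⟨e, he, hue⟩ : ∃ e : Eu d, ‖e‖ = 1 ∧ u c = ‖u c‖ • e := by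
    by_cases h0 : u c = 0
    · have : Nontrivial (Eu d) := inferInstance
      obtain ⟨e, he⟩ := exists_norm_eq (Eu d) zero_le_one
      exact ⟨e, he, by simp [h0]⟩
    · refine ⟨‖u c‖⁻¹ • u c, by simp [norm_smul, h0], ?_⟩
      rw [smul_smul, mul_inv_cancel₀ (norm_ne_zero_iff.2 h0), one_smul]
  obtain ⟨ε, hε, hSε⟩ : ∃ ε : ℝ, |ε| = 1 ∧ S * ε = |S| := by
    rcases le_total 0 S with h | h
    · exact ⟨1, by simp, by rw [mul_one, abs_of_nonneg h]⟩
    · exact ⟨-1, by simp, by rw [mul_neg_one, abs_of_nonpos h]⟩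
  -- The centre moves along `±u(c)`, with the sign that makes the linear part reinforce `u(c)`.
  -- Hence `‖u c'‖ = ‖u c‖ + |S|ρ/2`, and half of the gain survives on the ball of radius `ρ/4`.
  set c' : Eu d := c + (ε * (ρ / 2)) • e with hc'
  have hcc' : dist c' c = ρ / 2 := by
    rw [dist_eq_norm, hc', add_sub_cancel_left, norm_smul, he, mul_one, Real.norm_eq_abs, abs_mul,
      hε, one_mul, abs_of_pos (by linarith)]
  have hsub : Metric.closedBall c' (ρ / 4) ⊆ hull s :=
    (Metric.closedBall_subset_closedBall' (by rw [hcc']; linarith)).trans hball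
  refine ⟨c', hsub, fun x hx k => ?_⟩
  have hlow : ‖u c‖ + |S| * (ρ / 4) ≤ ‖u x‖ := by
    have h1 : u c' = (‖u c‖ + |S| * (ρ / 2)) • e := by
      rw [hlin c' c, hc', add_sub_cancel_left, smul_smul, ← mul_assoc, hSε, add_smul, ← hue]
    have h2 : ‖u c'‖ = ‖u c‖ + |S| * (ρ / 2) := by
      rw [h1, norm_smul, he, mul_one, Real.norm_of_nonneg (by positivity)]
    have h3 : ‖u c'‖ ≤ ‖u x‖ + |S| * (ρ / 4) := by
      rw [hlin c' x]
      refine (norm_add_le _ _).trans ?_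
      rw [norm_smul, Real.norm_eq_abs, ← dist_eq_norm, dist_comm]
      have := Metric.mem_closedBall.1 hx
      gcongr
    rw [h2] at h3
    linarith
  obtain ⟨i, hi⟩ := exists_ne k
  obtain ⟨ν, hν1, hν⟩ := exists_unit_normal s k
  -- The degree of freedom `a k` is the normal component of `u` at any vertex of the face.
  have hak : |a k| ≤ ‖u (s.points i)‖ := by
    rw [← inner_normal_sum_rtBasis a hi hν]
    refine (abs_real_inner_le_norm _ _).trans ?_
    rw [hν1, mul_one]
  have hdist : dist (s.points i) c ≤ σ * ρ :=
    (Metric.dist_le_diam_of_mem (Grid.isCompact_hull s).isBounded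
      (subset_convexHull ℝ _ ⟨i, rfl⟩) (hball (Metric.mem_closedBall_self hρ.le))).trans hdiam
  have hui : ‖u (s.points i)‖ ≤ ‖u c‖ + |S| * (σ * ρ) := by
    rw [hlin (s.points i) c]
    refine (norm_add_le _ _).trans ?_
    rw [norm_smul, Real.norm_eq_abs, ← dist_eq_norm]
    gcongr
  calc |a k| ≤ 1 * ‖u c‖ + (4 * σ) * (|S| * (ρ / 4)) := by linarith
    _ ≤ max 1 (4 * σ) * ‖u c‖ + max 1 (4 * σ) * (|S| * (ρ / 4)) := by
        gcongr
        · exact le_max_left _ _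
        · exact le_max_right _ _
    _ = max 1 (4 * σ) * (‖u c‖ + |S| * (ρ / 4)) := by ring
    _ ≤ _ := by gcongr

variable {q : Eu d → ℝ} {qL qU : ℝ}

/-- The degrees of freedom are bounded by the weighted norm of a Raviart-Thomas function. -/
theorem sq_mul_volume_le (hρ : 0 < ρ) (hball : Metric.closedBall c ρ ⊆ hull s)
    (hdiam : Metric.diam (hull s) ≤ σ * ρ) (hq : Continuous q) (hqL : 0 ≤ qL)
    (hL : ∀ v, qL * ‖v‖ ^ 2 ≤ q v) (a : Fin (d + 1) → ℝ) (k : Fin (d + 1)) :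
    qL * (a k ^ 2 * volume.real (Metric.closedBall c (ρ / 4))) ≤
      max 1 (4 * σ) ^ 2 * ∫ x in hull s, q (∑ j, a j • rtBasis s j x) := by
  obtain ⟨c', hsub, hc'⟩ := exists_ball_abs_le_norm hρ hball hdiam a
  have hcont : Continuous fun x => q (∑ j, a j • rtBasis s j x) :=
    hq.comp (continuous_finsetSum _ fun j _ => (continuous_rtBasis j).fun_const_smul (a j))
  have hint : ∀ t : Set (Eu d), IsCompact t →
      IntegrableOn (fun x => q (∑ j, a j • rtBasis s j x)) t := fun t ht =>
    hcont.continuousOn.integrableOn_compact ht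
  -- The good ball depends on `a`, but its volume does not; the fixed centre `c` lets this bound be
  -- combined with `integral_rtBasis_le`.
  have hvol : volume.real (Metric.closedBall c (ρ / 4)) =
      volume.real (Metric.closedBall c' (ρ / 4)) := by
    rw [Measure.real, Measure.real, Measure.addHaar_closedBall _ c (by positivity),
      Measure.addHaar_closedBall _ c' (by positivity)]
  have h1 : ∫ x in Metric.closedBall c' (ρ / 4), q (∑ j, a j • rtBasis s j x) ≤
      ∫ x in hull s, q (∑ j, a j • rtBasis s j x) := by
    refine setIntegral_mono_set (hint _ (Grid.isCompact_hull s)) ?_ hsub.eventuallyLE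
    exact Filter.Eventually.of_forall fun x => (mul_nonneg hqL (sq_nonneg _)).trans (hL _)
  have h2 : ∫ x in Metric.closedBall c' (ρ / 4), qL * a k ^ 2 ≤
      ∫ x in Metric.closedBall c' (ρ / 4),
        max 1 (4 * σ) ^ 2 * q (∑ j, a j • rtBasis s j x) := by
    refine setIntegral_mono_on ?_ ?_ measurableSet_closedBall fun x hx => ?_
    · exact continuous_const.continuousOn.integrableOn_compact (isCompact_closedBall _ _)
    · exact (hint _ (isCompact_closedBall _ _)).const_mul _
    · have h3 := hc' x hx k
      have h4 : a k ^ 2 ≤ max 1 (4 * σ) ^ 2 * ‖∑ j, a j • rtBasis s j x‖ ^ 2 := by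
        rw [← sq_abs (a k), ← mul_pow]
        gcongr
      calc qL * a k ^ 2 ≤ qL * (max 1 (4 * σ) ^ 2 * ‖∑ j, a j • rtBasis s j x‖ ^ 2) := by gcongr
        _ = max 1 (4 * σ) ^ 2 * (qL * ‖∑ j, a j • rtBasis s j x‖ ^ 2) := by ring
        _ ≤ _ := by gcongr; exact hL _
  rw [setIntegral_const, integral_const_mul, smul_eq_mul] at h2
  calc qL * (a k ^ 2 * volume.real (Metric.closedBall c (ρ / 4)))
      = volume.real (Metric.closedBall c' (ρ / 4)) * (qL * a k ^ 2) := by rw [hvol]; ring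
    _ ≤ _ := h2
    _ ≤ _ := by gcongr

/-- The basis function is at most diameter over height, and the height is at least `2ρ`; this costs
two powers of `max 1 (4σ)`. The other `d` powers come from enclosing the element in a ball of radius
`σρ = 4σ · ρ/4`. -/
theorem integral_rtBasis_le (hρ : 0 < ρ) (hball : Metric.closedBall c ρ ⊆ hull s)
    (hdiam : Metric.diam (hull s) ≤ σ * ρ) (hq : Continuous q) (hqU : 0 ≤ qU)
    (hU : ∀ v, q v ≤ qU * ‖v‖ ^ 2) (k : Fin (d + 1)) :
    ∫ x in hull s, q (rtBasis s k x) ≤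
      qU * (max 1 (4 * σ) ^ (d + 2) * volume.real (Metric.closedBall c (ρ / 4))) := by
  have hσ : 0 ≤ σ := nonneg_of_mul_nonneg_left (Metric.diam_nonneg.trans hdiam) hρ
  have hh := two_mul_le_height hρ.le hball k
  have hcont : Continuous fun x => q (rtBasis s k x) := hq.comp (continuous_rtBasis k)
  set τ := max 1 (4 * σ)
  have hτσ : 4 * σ ≤ τ := le_max_right _ _
  have h1 : ∫ x in hull s, q (rtBasis s k x) ≤ ∫ x in hull s, qU * τ ^ 2 := by
    refine setIntegral_mono_on ?_ ?_ (measurableSet_hull s) fun x hx => ?_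
    · exact hcont.continuousOn.integrableOn_compact (Grid.isCompact_hull s)
    · exact continuous_const.continuousOn.integrableOn_compact (Grid.isCompact_hull s)
    · refine (hU _).trans ?_
      gcongr
      rw [rtBasis, norm_smul, norm_inv, Real.norm_of_nonneg (by linarith), ← dist_eq_norm,
        inv_mul_le_iff₀ (by linarith)]
      have : dist x (s.points k) ≤ σ * ρ :=
        (Metric.dist_le_diam_of_mem (Grid.isCompact_hull s).isBounded hx
          (subset_convexHull ℝ _ ⟨k, rfl⟩)).trans hdiam
      nlinarith
  have h2 : volume.real (hull s) ≤ τ ^ d * volume.real (Metric.closedBall c (ρ / 4)) := by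
    have hsub : hull s ⊆ Metric.closedBall c ((4 * σ) * (ρ / 4)) := by
      intro x hx
      rw [Metric.mem_closedBall]
      have := Metric.dist_le_diam_of_mem (Grid.isCompact_hull s).isBounded hx
        (hball (Metric.mem_closedBall_self hρ.le))
      linarith
    refine (measureReal_mono hsub (isCompact_closedBall _ _).measure_lt_top.ne).trans ?_
    rw [Measure.real, Measure.addHaar_closedBall_mul _ _ (by positivity) (by positivity),
      finrank_euclideanSpace_fin, ENNReal.toReal_mul, ENNReal.toReal_ofReal (by positivity),
      Measure.real, Measure.addHaar_closedBall_center _ c]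
    gcongr
  rw [setIntegral_const, smul_eq_mul] at h1
  calc _ ≤ _ := h1
    _ ≤ τ ^ d * volume.real (Metric.closedBall c (ρ / 4)) * (qU * τ ^ 2) := by gcongr
    _ = _ := by ring

/-- The diagonal of the weighted element mass matrix is bounded by the element mass matrix. -/
theorem sum_sq_mul_integral_le (hρ : 0 < ρ) (hball : Metric.closedBall c ρ ⊆ hull s)
    (hdiam : Metric.diam (hull s) ≤ σ * ρ) (hq : Continuous q) (hqL : 0 < qL) (hqU : 0 ≤ qU)
    (hL : ∀ v, qL * ‖v‖ ^ 2 ≤ q v) (hU : ∀ v, q v ≤ qU * ‖v‖ ^ 2) (a : Fin (d + 1) → ℝ) :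
    ∑ k, a k * a k * ∫ x in hull s, q (rtBasis s k x) ≤
      (d + 1) * max 1 (4 * σ) ^ (d + 4) * (qU / qL) *
        ∫ x in hull s, q (∑ j, a j • rtBasis s j x) := by
  set τ := max 1 (4 * σ)
  have hτ : 0 ≤ τ := zero_le_one.trans (le_max_left _ _)
  set I := ∫ x in hull s, q (∑ j, a j • rtBasis s j x)
  have h : ∀ k, a k * a k * ∫ x in hull s, q (rtBasis s k x) ≤ τ ^ (d + 4) * (qU / qL) * I := by
    intro k
    have h1 := sq_mul_volume_le hρ hball hdiam hq hqL.le hL a k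
    have h2 := integral_rtBasis_le hρ hball hdiam hq hqU hU k
    calc _ ≤ a k * a k *
          (qU * (τ ^ (d + 2) * volume.real (Metric.closedBall c (ρ / 4)))) :=
          mul_le_mul_of_nonneg_left h2 (mul_self_nonneg _)
      _ = (qU / qL) * τ ^ (d + 2) *
          (qL * (a k ^ 2 * volume.real (Metric.closedBall c (ρ / 4)))) := by
          field_simp
      _ ≤ (qU / qL) * τ ^ (d + 2) * (τ ^ 2 * I) := by gcongr
      _ = _ := by ring
  refine (Finset.sum_le_sum fun k _ => h k).trans_eq ?_
  simp
  ring

end Element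

/-! ### Spectral equivalence of the mass matrix and its diagonal -/

namespace Grid

variable {n : ℕ} {M : Grid n}

theorem cdim_le (T : M.Cell) : M.cdim T ≤ n := by
  have h := LinearMap.finrank_le_finrank_of_injective
    (f := (M.chart (M.sub T)).toAffineMap.linear)
    ((AffineMap.linear_injective_iff _).2 (M.chart (M.sub T)).injective)
  simpa [cdim] using h

namespace Params

variable (P : M.Params)

theorem mass_apply (c c' : M.Face → ℝ) : P.mass c c' = ∑ T, ∫ x in hull (M.simplex T),
    inner ℝ (P.invK (M.sub T) (M.field T c x)) (M.field T c' x) := rfl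

theorem massD_apply (c c' : M.Face → ℝ) : P.massD c c' =
    ∑ T, ∑ k, c ⟨T, k⟩ * c' ⟨T, k⟩ * ∫ x in hull (M.simplex T),
      inner ℝ (P.invK (M.sub T) (rtBasis (M.simplex T) k x)) (rtBasis (M.simplex T) k x) := rfl

theorem mortarMass_apply (l μ : M.MortarSpace) : P.mortarMass l μ =
    ∑ m, P.γ (M.ifc m) * (P.Kν (M.ifc m))⁻¹ * (l m * μ m) *
      volume.real (hull (M.mortarSimplex m)) := rfl

theorem opA_apply (w r : M.W) : P.opA w r =
    P.mass (M.totalFlux w) (M.totalFlux r) + P.mortarMass w.2 r.2 := rfl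

theorem opDA_apply (w r : M.W) : P.opDA w r =
    P.massD (M.totalFlux w) (M.totalFlux r) + P.mortarMass w.2 r.2 := rfl

theorem invK_comm (i : M.Sub) (u v : Eu (M.dim i)) :
    inner ℝ (P.invK i u) v = inner ℝ (P.invK i v) u :=
  inner_toEuclideanLin_comm (P.K_posDef i).inv u v

theorem invK_nonneg (i : M.Sub) (u : Eu (M.dim i)) : 0 ≤ inner ℝ (P.invK i u) u :=
  inner_toEuclideanLin_nonneg (P.K_posDef i).inv u

theorem continuous_invK (i : M.Sub) : Continuous fun u => inner ℝ (P.invK i u) u :=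
  (LinearMap.continuous_of_finiteDimensional (P.invK i)).inner continuous_id

theorem mass_comm (c c' : M.Face → ℝ) : P.mass c c' = P.mass c' c := by
  simp only [mass_apply]
  refine Finset.sum_congr rfl fun T _ => integral_congr_ae (Filter.Eventually.of_forall fun x => ?_)
  exact P.invK_comm _ _ _

theorem massD_comm (c c' : M.Face → ℝ) : P.massD c c' = P.massD c' c := by
  simp only [massD_apply, mul_comm (c _) (c' _)]

theorem mortarMass_comm (l μ : M.MortarSpace) : P.mortarMass l μ = P.mortarMass μ l := by
  simp only [mortarMass_apply, mul_comm (l _) (μ _)]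

theorem mortarMass_term_nonneg (l : M.MortarSpace) (m : M.Mortar) :
    0 ≤ P.γ (M.ifc m) * (P.Kν (M.ifc m))⁻¹ * (l m * l m) *
      volume.real (hull (M.mortarSimplex m)) := by
  have := P.γ_pos (M.ifc m)
  have := P.Kν_pos (M.ifc m)
  have := mul_self_nonneg (l m)
  positivity

theorem mortarMass_nonneg (l : M.MortarSpace) : 0 ≤ P.mortarMass l l :=
  Finset.sum_nonneg fun m _ => P.mortarMass_term_nonneg l m

theorem mortarMass_pos {l : M.MortarSpace} (h : l ≠ 0) : 0 < P.mortarMass l l := by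
  obtain ⟨m, hm⟩ := Function.ne_iff.1 h
  refine Finset.sum_pos' (fun m _ => P.mortarMass_term_nonneg l m) ⟨m, Finset.mem_univ m, ?_⟩
  have := P.γ_pos (M.ifc m)
  have := P.Kν_pos (M.ifc m)
  have := volume_real_hull_pos (M.mortarSimplex m)
  have : 0 < l m * l m := mul_self_pos.2 hm
  positivity

theorem massD_term_nonneg (c : M.Face → ℝ) (T : M.Cell) (k : Fin (M.dim (M.sub T) + 1)) :
    0 ≤ c ⟨T, k⟩ * c ⟨T, k⟩ * ∫ x in hull (M.simplex T),
      inner ℝ (P.invK (M.sub T) (rtBasis (M.simplex T) k x)) (rtBasis (M.simplex T) k x) :=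
  mul_nonneg (mul_self_nonneg _) (integral_nonneg fun _ => P.invK_nonneg _ _)

theorem massD_nonneg (c : M.Face → ℝ) : 0 ≤ P.massD c c :=
  Finset.sum_nonneg fun T _ => Finset.sum_nonneg fun k _ => P.massD_term_nonneg c T k

/-- The mass matrix is bounded by its diagonal. -/
theorem mass_le_massD (c : M.Face → ℝ) : P.mass c c ≤ (n + 1) * P.massD c c := by
  rw [mass_apply, massD_apply, Finset.mul_sum]
  refine Finset.sum_le_sum fun T _ => ?_
  have hint : ∀ k, IntegrableOn (fun x => c ⟨T, k⟩ * c ⟨T, k⟩ *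
      inner ℝ (P.invK (M.sub T) (rtBasis (M.simplex T) k x)) (rtBasis (M.simplex T) k x))
      (hull (M.simplex T)) := fun k =>
    (((P.continuous_invK _).comp (continuous_rtBasis k)).continuousOn.integrableOn_compact
      (isCompact_hull _)).const_mul _
  calc _ ≤ ∫ x in hull (M.simplex T), ((n : ℝ) + 1) * ∑ k, c ⟨T, k⟩ * c ⟨T, k⟩ *
        inner ℝ (P.invK (M.sub T) (rtBasis (M.simplex T) k x)) (rtBasis (M.simplex T) k x) := by
        refine setIntegral_mono_on (P.integrableOn_inner T c c)
          ((integrable_finsetSum _ fun k _ => hint k).const_mul _) (measurableSet_hull _)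
          fun x _ => ?_
        refine (inner_sum_le (P.K_posDef (M.sub T)).inv _).trans ?_
        rw [Fintype.card_fin, Nat.cast_add, Nat.cast_one]
        have hd : ((M.dim (M.sub T) : ℕ) : ℝ) ≤ n := by exact_mod_cast cdim_le T
        refine mul_le_mul (by linarith) (le_of_eq ?_) ?_ (by positivity)
        · refine Finset.sum_congr rfl fun k _ => ?_
          rw [map_smul, real_inner_smul_left, real_inner_smul_right, ← mul_assoc]
          rfl
        · exact Finset.sum_nonneg fun k _ =>
            inner_toEuclideanLin_nonneg (P.K_posDef (M.sub T)).inv _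
    _ = _ := by
        rw [integral_const_mul, integral_finsetSum _ fun k _ => hint k]
        simp only [integral_const_mul]

variable {P} {σ κ : ℝ}

/-- Bounds for the quadratic form of the inverse of the permeability. -/
theorem AnisotropyLE.exists_bounds (hK : P.AnisotropyLE κ) (i : M.Sub) (hi : 0 < M.dim i) :
    ∃ qL qU : ℝ, 0 < qL ∧ 0 ≤ qU ∧ qU / qL = κ ^ 2 ∧
      (∀ v, qL * ‖v‖ ^ 2 ≤ inner ℝ (P.invK i v) v) ∧
      ∀ v, inner ℝ (P.invK i v) v ≤ qU * ‖v‖ ^ 2 := by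
  have : NeZero (M.dim i) := ⟨hi.ne'⟩
  obtain ⟨e, he⟩ := exists_norm_eq (Eu (M.dim i)) zero_le_one
  have he0 : e ≠ 0 := by
    rw [← norm_ne_zero_iff, he]
    exact one_ne_zero
  have hβ : 0 < inner ℝ (P.invK i e) e := inner_toEuclideanLin_pos (P.K_posDef i).inv he0
  have h : ∀ u v, inner ℝ (P.invK i u) u * ‖v‖ ^ 2 ≤ κ * inner ℝ (P.invK i v) v * ‖u‖ ^ 2 :=
    anisotropy_inv (P.K_posDef i) (hK i)
  have hκ : 0 < κ := by
    have := h e e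
    rw [he] at this
    nlinarith
  -- Both bounds compare with one fixed unit vector `e`; each comparison costs a factor `κ`, whence
  -- the ratio `κ ^ 2`.
  refine ⟨inner ℝ (P.invK i e) e / κ, κ * inner ℝ (P.invK i e) e, by positivity, by positivity,
    by field_simp, fun v => ?_, fun v => ?_⟩
  · have := h e v
    rw [he] at this
    rw [div_mul_eq_mul_div, div_le_iff₀ hκ]
    linarith
  · have := h v e
    rw [he] at this
    linarith

theorem massD_pos (hσ : M.ShapeRegular σ) (hK : P.AnisotropyLE κ) {c : M.Face → ℝ} {f : M.Face}
    (hf : 0 < M.cdim f.1) (hc : c f ≠ 0) : 0 < P.massD c c := by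
  classical
  have : NeZero (M.dim (M.sub f.1)) := ⟨hf.ne'⟩
  obtain ⟨T, k⟩ := f
  refine Finset.sum_pos' (fun T _ => Finset.sum_nonneg fun k _ => P.massD_term_nonneg c T k)
    ⟨T, Finset.mem_univ T, Finset.sum_pos' (fun k _ => P.massD_term_nonneg c T k)
      ⟨k, Finset.mem_univ k, mul_pos (mul_self_pos.2 hc) ?_⟩⟩
  obtain ⟨b, ρ, hρ, hball, hdiam⟩ := hσ T
  obtain ⟨qL, qU, hqL, -, -, hL, -⟩ := hK.exists_bounds (M.sub T) hf
  have h := sq_mul_volume_le hρ hball hdiam (P.continuous_invK _) hqL.le hL (Pi.single k 1) k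
  have hv : 0 < volume.real (Metric.closedBall b (ρ / 4)) :=
    ENNReal.toReal_pos (Metric.measure_closedBall_pos _ _ (by positivity)).ne'
      (isCompact_closedBall _ _).measure_lt_top.ne
  have hs : ∀ x, ∑ j, (Pi.single k 1 : Fin (M.dim (M.sub T) + 1) → ℝ) j •
      rtBasis (M.simplex T) j x = rtBasis (M.simplex T) k x := by
    intro x
    simp [Pi.single_apply, ite_smul]
  simp only [hs, Pi.single_eq_same, one_pow, one_mul] at h
  exact pos_of_mul_pos_right ((mul_pos hqL hv).trans_le h) (sq_nonneg _)

/-- The diagonal of the mass matrix is bounded by the mass matrix. -/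
theorem massD_le_mass (hσ : M.ShapeRegular σ) (hK : P.AnisotropyLE κ) (c : M.Face → ℝ) :
    P.massD c c ≤ (n + 1) * max 1 (4 * σ) ^ (n + 4) * κ ^ 2 * P.mass c c := by
  rw [mass_apply, massD_apply, Finset.mul_sum]
  refine Finset.sum_le_sum fun T _ => ?_
  have hτ : 1 ≤ max 1 (4 * σ) := le_max_left _ _
  have hI : 0 ≤ ∫ x in hull (M.simplex T),
      inner ℝ (P.invK (M.sub T) (M.field T c x)) (M.field T c x) :=
    integral_nonneg fun _ => P.invK_nonneg _ _
  rcases Nat.eq_zero_or_pos (M.dim (M.sub T)) with h0 | h0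
  -- On a point element all basis functions vanish.
  · have hs : Subsingleton (Eu (M.dim (M.sub T))) := by
      rw [h0]; infer_instance
    rw [Finset.sum_eq_zero]
    · positivity
    · intro k _
      simp [Subsingleton.elim (rtBasis (M.simplex T) k _) 0]
  · have : NeZero (M.dim (M.sub T)) := ⟨h0.ne'⟩
    obtain ⟨b, ρ, hρ, hball, hdiam⟩ := hσ T
    obtain ⟨qL, qU, hqL, hqU, hq, hL, hU⟩ := hK.exists_bounds (M.sub T) h0
    have h := sum_sq_mul_integral_le hρ hball hdiam (P.continuous_invK _) hqL hqU hL hU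
      fun k => c ⟨T, k⟩
    rw [hq] at h
    refine h.trans ?_
    have hd : M.dim (M.sub T) ≤ n := cdim_le T
    have hd' : ((M.dim (M.sub T) : ℕ) : ℝ) ≤ n := by exact_mod_cast hd
    refine mul_le_mul_of_nonneg_right ?_ hI
    gcongr

theorem opDA_isSPD (hσ : M.ShapeRegular σ) (hK : P.AnisotropyLE κ) : IsSPD P.opDA := by
  refine ⟨fun w r => by rw [opDA_apply, opDA_apply, massD_comm, mortarMass_comm], ?_⟩
  rintro ⟨u, l⟩ hw
  rw [opDA_apply]
  by_cases hl : l = 0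
  · subst hl
    obtain ⟨u, hu⟩ := u
    have hu0 : u ≠ 0 := by
      rintro rfl
      exact hw rfl
    obtain ⟨f, hf⟩ := Function.ne_iff.1 hu0
    -- `massD` does not see the coefficients on point elements; the flux space sets them to zero.
    have hfd : 0 < M.cdim f.1 := Nat.pos_of_ne_zero fun h => hf (hu.1.2.2 f h)
    have ht : M.totalFlux (⟨u, hu⟩, 0) = u := by simp [totalFlux]
    rw [ht]
    exact add_pos_of_pos_of_nonneg (massD_pos hσ hK hfd hf) (P.mortarMass_nonneg _)
  · exact add_pos_of_nonneg_of_pos (P.massD_nonneg _) (P.mortarMass_pos hl)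

theorem opA_le_opDA (w : M.W) : P.opA w w ≤ (n + 1) * P.opDA w w := by
  rw [opA_apply, opDA_apply, mul_add]
  refine add_le_add (P.mass_le_massD _) (le_mul_of_one_le_left (P.mortarMass_nonneg _) ?_)
  have : (0 : ℝ) ≤ n := n.cast_nonneg
  linarith

theorem opDA_le_opA (hσ : M.ShapeRegular σ) (hK : P.AnisotropyLE κ) (w : M.W) :
    P.opDA w w ≤ (1 + (n + 1) * max 1 (4 * σ) ^ (n + 4) * κ ^ 2) * P.opA w w := by
  have hτ : 1 ≤ max 1 (4 * σ) := le_max_left _ _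
  have hC : 0 ≤ (n + 1) * max 1 (4 * σ) ^ (n + 4) * κ ^ 2 := by positivity
  have hm : 0 ≤ P.mass (M.totalFlux w) (M.totalFlux w) :=
    Finset.sum_nonneg fun T _ => integral_nonneg fun _ => P.invK_nonneg _ _
  have h := massD_le_mass hσ hK (M.totalFlux w)
  have hl := P.mortarMass_nonneg w.2
  rw [opA_apply, opDA_apply]
  nlinarith [mul_nonneg hC hl]

/-- Definiteness is inherited from `opDA` through `opDA_le_opA`. -/
theorem opA_isSPD (hσ : M.ShapeRegular σ) (hK : P.AnisotropyLE κ) : IsSPD P.opA := by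
  refine ⟨fun w r => by rw [opA_apply, opA_apply, mass_comm, mortarMass_comm], fun w hw => ?_⟩
  refine pos_of_mul_pos_right (((opDA_isSPD hσ hK).pos w hw).trans_le (opDA_le_opA hσ hK w)) ?_
  have hτ : 1 ≤ max 1 (4 * σ) := le_max_left _ _
  positivity

end Params

end Grid

end MixedDim

end

theorem mainTheorem8 (n : ℕ) (hn : n = 2 ∨ n = 3) (σ : ℝ) :
    ∃ ξ₁ : ℝ, 0 < ξ₁ ∧ ∀ κ : ℝ, ∃ ξ₂ : ℝ, 0 < ξ₂ ∧
      ∀ (M : MixedDim.Grid n), M.IsAdmissible → M.ShapeRegular σ →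
      ∀ P : M.Params, P.AnisotropyLE κ →
        -- the preconditioners are well defined
        Function.Bijective P.opDA ∧ Function.Bijective P.blockD ∧ Function.Bijective P.blockU ∧
        -- `(·, ·)_{B_D}` is an inner product
        (∀ x' y', MixedDim.dualInner P.calBD x' y' = MixedDim.dualInner P.calBD y' x') ∧
        (∀ x', x' ≠ 0 → 0 < MixedDim.dualInner P.calBD x' x') ∧
        -- the bounds
        ∀ x : M.W × M.Q, x ≠ 0 → ∀ x', x' = P.blockU x →
          ξ₁ ≤ MixedDim.dualInner P.calBD (P.calA (P.calBU x')) x' /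
              MixedDim.dualInner P.calBD x' x' ∧
          MixedDim.dualNorm P.calBD (P.calA (P.calBU x')) / MixedDim.dualNorm P.calBD x' ≤ ξ₂ := by
  have hC : 0 ≤ ((n : ℝ) + 1) * max 1 (4 * σ) ^ (n + 4) := by
    have hτ : 1 ≤ max 1 (4 * σ) := le_max_left _ _
    positivity
  -- The lower constant uses `c₁ = n + 1` only, so it can be chosen before `κ`; `c₂` enters the
  -- upper constant alone.
  refine ⟨(2 * (2 + ((n : ℝ) + 1)))⁻¹, by positivity, fun κ => ?_⟩
  have hC' : 0 ≤ 1 + ((n : ℝ) + 1) * max 1 (4 * σ) ^ (n + 4) * κ ^ 2 := by positivity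
  refine ⟨_, Real.sqrt_pos.2 ?_, fun M hM hσ P hK =>
    MixedDim.block_preconditioner (by positivity) hC'
      (MixedDim.Grid.Params.opA_isSPD hσ hK) (MixedDim.Grid.Params.opDA_isSPD hσ hK)
      (MixedDim.Grid.opB_flip_injective hM) MixedDim.Grid.Params.opA_le_opDA
      (MixedDim.Grid.Params.opDA_le_opA hσ hK)⟩
  positivity
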